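/- Let $m=(m_0,m_1,\dots)$ be a bounded sequence of integers $m_j\ge 2$, and let $G_m=\prod_{j\ge0}\mathbb Z/m_j\mathbb Z$ be the corresponding bounded Vilenkin group, a compact group with normalized Haar measure; let $\mu$ be the normalized Haar measure of $G_m^2=G_m\times G_m$. Put $M_0=1$, $M_{k+1}=m_kM_k$ and $I_n=\{x\in G_m: x_0=\dots=x_{n-1}=0\}$ (so $I_0=G_m$). For $n=\sum_j n_jM_j$ with $0\le n_j<m_j$ let $\psi_n(x)=\prod_j \exp(2\pi i\,n_jx_j/m_j)$ be the Vilenkin functions. For $f\in L^1(G_m^2)$ let $$\widehat f(n_1,n_2)=\int_{G_m^2} f(x,y)\,\overline{\psi_{n_1}(x)}\,\overline{\psi_{n_2}(y)}\,d\mu(x,y),\qquad S_{j,j}(f)(x,y)=\sum_{k_1=0}^{j-1}\sum_{k_2=0}^{j-1}\widehat f(k_1,k_2)\psi_{k_1}(x)\psi_{k_2}(y),$$ and for $\alpha\in(0,1)$ and $n\ge1$ let $$\sigma_n^{-\alpha}(f)=\frac1{A_{n-1}^{-\alpha}}\sum_{j=1}^n A_{n-j}^{-\alpha-1}S_{j,j}(f),\qquad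 A_0^\beta=1,\quad A_n^\beta=\frac{(\beta+1)\cdots(\beta+n)}{n!}.$$ For $1\le p<\infty$ let $\|\cdot\|_p$ be the norm of $L^p(G_m^2)$; for $p=\infty$ let $L^\infty(G_m^2)$ denote the space $C(G_m^2)$ of continuous complex functions with the supremum norm $\|\cdot\|_\infty$. The dyadic partial moduli of continuity are $$\omega_1(f,1/M_n)_p=\sup_{u\in I_n}\|f(\cdot+u,\cdot)-f\|_p,\qquad \omega_2(f,1/M_n)_p=\sup_{v\in I_n}\|f(\cdot,\cdot+v)-f\|_p .$$ Theorem. For every $\alpha\in(0,1)$ and every $B$ there is a constant $c$, depending only on $\alpha$ and $B$, such that for every sequence $m$ as above with $\sup_j m_j\le B$, every $p\in[1,\infty]$, every $f\in L^p(G_m^2)$ and every integer $k\ge1$, $$\|\sigma_{M_k}^{-\alpha}(f)-f\|_p\le c\Big(M_k^\alpha\,\omega_1(f,1/M_{k-1})_p+M_k^\alpha\,\omega_2(f,1/M_{k-1})_p+\sum_{r=0}^{k-2}\frac{M_r}{M_k}\big(\omega_1(f,1/M_r)_p+\omega_2(f,1/M_r)_p\big)\Big),$$ where the sum is empty for $k=1$.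 -/

import Mathlib

open MeasureTheory
open scoped NNReal ENNReal

noncomputable section

namespace Vilenkin

/-- The Vilenkin group `G_m`: the complete direct product of the cyclic groups `ℤ/m_k`, with
coordinatewise addition, the product topology and the product `σ`-algebra (each factor is
discrete). -/
abbrev Group (m : ℕ → ℕ) : Type := ∀ k, ZMod (m k)

/-- The Haar probability measure of `G_m`: the product of the uniform probability measures on the
factors `ℤ/m_k`. -/
def haar (m : ℕ → ℕ) [∀ k, NeZero (m k)] : Measure (Group m) :=
  Measure.infinitePi fun k => ProbabilityTheory.uniformOn (Set.univ : Set (ZMod (m k)))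

instance (m : ℕ → ℕ) [∀ k, NeZero (m k)] : IsProbabilityMeasure (haar m) := by
  unfold haar; infer_instance

/-- The Haar probability measure of `G_m × G_m`. -/
def haar₂ (m : ℕ → ℕ) [∀ k, NeZero (m k)] : Measure (Group m × Group m) :=
  (haar m).prod (haar m)

instance (m : ℕ → ℕ) [∀ k, NeZero (m k)] : IsProbabilityMeasure (haar₂ m) := by
  unfold haar₂; infer_instance

/-- The subgroup `I_n` of all `x` whose coordinates `x_0, …, x_{n-1}` vanish. -/
def cyl (m : ℕ → ℕ) (n : ℕ) : Set (Group m) := {x | ∀ i < n, x i = 0}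

/-- The generalized powers `M_0 = 1`, `M_{k+1} = m_k M_k`. -/
def M (m : ℕ → ℕ) : ℕ → ℕ
  | 0 => 1
  | k + 1 => m k * M m k

/-- The digits `n_k ∈ {0, …, m_k - 1}` of `n` in the expansion `n = ∑_k n_k M_k`. -/
def digit (m : ℕ → ℕ) (n k : ℕ) : ℕ := n / M m k % m k

/-- The generalized Rademacher functions `r_k(x) = exp(2πi x_k / m_k)`. -/
def rademacher (m : ℕ → ℕ) (k : ℕ) (x : Group m) : ℂ :=
  Complex.exp (2 * Real.pi * Complex.I * ((x k).val : ℂ) / (m k : ℂ))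

/-- The Vilenkin functions `ψ_n = ∏_k r_k ^ n_k`. All the digits `n_k` with `k ≥ n` vanish
(see `digit_eq_zero`), so that the product over `k < n` is the whole product. -/
def psi (m : ℕ → ℕ) (n : ℕ) (x : Group m) : ℂ :=
  ∏ k ∈ Finset.range n, rademacher m k x ^ digit m n k

lemma lt_M (m : ℕ → ℕ) (hm : ∀ k, 2 ≤ m k) (k : ℕ) : k < M m k := by
  induction k with
  | zero => simp [M]
  | succ k ih =>
    have h := Nat.mul_le_mul_right (M m k) (hm k)
    simp only [M]
    omega

lemma digit_eq_zero (m : ℕ → ℕ) (hm : ∀ k, 2 ≤ m k) {n k : ℕ} (h : n ≤ k) :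
    digit m n k = 0 := by
  simp [digit, Nat.div_eq_of_lt (h.trans_lt (lt_M m hm k))]

/-- The double Vilenkin–Fourier coefficients. -/
def fourierCoeff (m : ℕ → ℕ) [∀ k, NeZero (m k)] (f : Group m × Group m → ℂ) (n₁ n₂ : ℕ) : ℂ :=
  ∫ z, f z * starRingEnd ℂ (psi m n₁ z.1) * starRingEnd ℂ (psi m n₂ z.2) ∂(haar₂ m)

/-- The rectangular partial sums `S_{n₁,n₂}(f)`. -/
def partialSum (m : ℕ → ℕ) [∀ k, NeZero (m k)] (n₁ n₂ : ℕ) (f : Group m × Group m → ℂ)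
    (z : Group m × Group m) : ℂ :=
  ∑ k₁ ∈ Finset.range n₁, ∑ k₂ ∈ Finset.range n₂,
    fourierCoeff m f k₁ k₂ * psi m k₁ z.1 * psi m k₂ z.2

/-- The Cesàro numbers `A_n^a = (a+1)(a+2)⋯(a+n) / n!`, `A_0^a = 1`. -/
def cesaroNumber (a : ℝ) (n : ℕ) : ℝ := (∏ i ∈ Finset.range n, (a + (i + 1))) / (n.factorial : ℝ)

/-- The `(C, a)` means of the quadratic partial sums,
`σ_n^a(f) = (1 / A_{n-1}^a) ∑_{j=1}^n A_{n-j}^{a-1} S_{j,j}(f)`, for `n ≥ 1`. -/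
def cesaroMean (m : ℕ → ℕ) [∀ k, NeZero (m k)] (a : ℝ) (n : ℕ) (f : Group m × Group m → ℂ)
    (z : Group m × Group m) : ℂ :=
  (1 / cesaroNumber a (n - 1) : ℝ) *
    ∑ j ∈ Finset.Icc 1 n, (cesaroNumber (a - 1) (n - j) : ℂ) * partialSum m j j f z

/-- Membership in `L^p(G_m × G_m)`, where `L^∞` stands for the space of continuous functions. -/
def InLp (m : ℕ → ℕ) [∀ k, NeZero (m k)] (p : ℝ≥0∞) (f : Group m × Group m → ℂ) : Prop :=
  if p = ∞ then Continuous f else MemLp f p (haar₂ m)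

/-- The norm of `L^p(G_m × G_m)`: the integral norm for `p < ∞`, the supremum norm for `p = ∞`. -/
def normLp (m : ℕ → ℕ) [∀ k, NeZero (m k)] (p : ℝ≥0∞) (f : Group m × Group m → ℂ) : ℝ≥0∞ :=
  if p = ∞ then ⨆ z, ‖f z‖ₑ else eLpNorm f p (haar₂ m)

/-- The dyadic partial modulus of continuity `ω₁(f, 1/M_n)_p` in the first variable. -/
def modulus₁ (m : ℕ → ℕ) [∀ k, NeZero (m k)] (p : ℝ≥0∞) (f : Group m × Group m → ℂ) (n : ℕ) :
    ℝ≥0∞ :=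
  ⨆ u ∈ cyl m n, normLp m p fun z => f (z.1 + u, z.2) - f z

/-- The dyadic partial modulus of continuity `ω₂(f, 1/M_n)_p` in the second variable. -/
def modulus₂ (m : ℕ → ℕ) [∀ k, NeZero (m k)] (p : ℝ≥0∞) (f : Group m × Group m → ℂ) (n : ℕ) :
    ℝ≥0∞ :=
  ⨆ v ∈ cyl m n, normLp m p fun z => f (z.1, z.2 + v) - f z

end Vilenkin

end

/-! Let N = M_k = M_{n+1} and w_i = A_i^{-α-1}. The weights w_{N-j}, 1 ≤ j ≤ N, add up to
A_{N-1}^{-α}, so σ_N f - f is the weighted sum of the differences S_{j,j} f - f divided by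
A_{N-1}^{-α}, and 1/A_{N-1}^{-α} ≤ N^α/(1-α). The sum is cut into the blocks M_r ≤ j < M_{r+1} with
r < n and the last block M_n ≤ j ≤ N.

If j ≥ M_r, then S_{j,j} reproduces S_{M_r,M_r} f, so f may be replaced by h = f - S_{M_r,M_r} f.
Since D_{M_r} is M_r times the indicator of I_r, the norm of h is at most ω₁ + ω₂ at level r. Each
block therefore costs at most twice the L¹ norm of its kernel ∑ w_{N-j} D_j ⊗ D_j times these moduli
(`normLp_block_le`), and everything reduces to L¹ estimates of kernels.

The basic estimate is that ∑_{i<L} D_i ⊗ D_i has L¹ norm O(M_r) for L ≤ M_r (`l1_marcinkiewicz_le`),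
together with its one-variable analogue (`l1_fejer_le`). Both come from a recursion along the
digits. Passing from M_r to M_{r+1} multiplies the old kernel by a full geometric sum of roots of
unity; averaging over translations of one coordinate shows that this leaves the L¹ norm unchanged.
The triangle inequality would give the factor m_r there and lose a logarithm.

In a lower block the weights are monotone of size O(N^{-1-α}), and Abel summation bounds the kernel
by O(M_r N^{-1-α}) (`l1_lower_kernel_le`); with the factor N^α this is M_r/N. In the last block the
weights are not small near j = N. The reflection D_{N-i} = D_N - ψ_{N-1} conj(D_i) turns that end
into i = 0, where ∑|w_i| ≤ 2 and Abel summation give a bounded kernel (`l1_upper_kernel_le`); only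
the factor N^α remains. -/

noncomputable section

set_option linter.unusedSectionVars false

namespace Vilenkin

/-! ### Invariance of the Haar measures -/

lemma map_uniformOn_univ {X : Type*} [Finite X] [MeasurableSpace X] [MeasurableSingletonClass X]
    (e : X ≃ X) :
    (ProbabilityTheory.uniformOn (Set.univ : Set X)).map e =
      ProbabilityTheory.uniformOn Set.univ := by
  have : DiscreteMeasurableSpace X := inferInstance
  ext s hs
  rw [Measure.map_apply (measurable_of_countable _) hs]
  simp only [ProbabilityTheory.uniformOn, ProbabilityTheory.cond_apply MeasurableSet.univ,
    Set.univ_inter]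
  congr 1
  rw [show e ⁻¹' s = e.symm '' s from (e.symm.image_eq_preimage_symm s).symm,
    Measure.count_injective_image e.symm.injective]

instance (m : ℕ → ℕ) [∀ k, NeZero (m k)] : (haar m).IsAddLeftInvariant := by
  refine ⟨fun g => ?_⟩
  have := Measure.infinitePi_map_pi
    (μ := fun k => ProbabilityTheory.uniformOn (Set.univ : Set (ZMod (m k))))
    (f := fun k x => g k + x) (fun _ => measurable_of_countable _)
  have h : ∀ k, (ProbabilityTheory.uniformOn (Set.univ : Set (ZMod (m k)))).map (fun x => g k + x)
      = ProbabilityTheory.uniformOn Set.univ := fun k => map_uniformOn_univ (Equiv.addLeft (g k))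
  simp only [h] at this
  exact this

instance (m : ℕ → ℕ) [∀ k, NeZero (m k)] : (haar m).IsNegInvariant := by
  refine ⟨?_⟩
  have := Measure.infinitePi_map_pi
    (μ := fun k => ProbabilityTheory.uniformOn (Set.univ : Set (ZMod (m k))))
    (f := fun k x => -x) (fun _ => measurable_of_countable _)
  have h : ∀ k, (ProbabilityTheory.uniformOn (Set.univ : Set (ZMod (m k)))).map (fun x => -x)
      = ProbabilityTheory.uniformOn Set.univ := fun k => map_uniformOn_univ (Equiv.neg _)
  simp only [h] at this
  exact this

instance (m : ℕ → ℕ) [∀ k, NeZero (m k)] : (haar₂ m).IsAddLeftInvariant := by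
  refine ⟨fun g => ?_⟩
  have := ((measurePreserving_add_left (haar m) g.1).prod
    (measurePreserving_add_left (haar m) g.2)).map_eq
  exact this

instance (m : ℕ → ℕ) [∀ k, NeZero (m k)] : (haar₂ m).IsNegInvariant := by
  refine ⟨?_⟩
  have := ((Measure.measurePreserving_neg (haar m)).prod
    (Measure.measurePreserving_neg (haar m))).map_eq
  exact this

/-! ### The generalized powers and digits -/

lemma M_pos (m : ℕ → ℕ) (hm : ∀ k, 2 ≤ m k) (k : ℕ) : 0 < M m k :=
  (Nat.zero_le k).trans_lt (lt_M m hm k)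

lemma M_dvd_M (m : ℕ → ℕ) {k r : ℕ} (h : k ≤ r) : M m k ∣ M m r := by
  induction r, h using Nat.le_induction with
  | base => exact dvd_rfl
  | succ r _ ih => exact ih.trans (Dvd.intro_left _ rfl)

lemma M_mono (m : ℕ → ℕ) (hm : ∀ k, 2 ≤ m k) : Monotone (M m) := fun _ _ h =>
  Nat.le_of_dvd (M_pos m hm _) (M_dvd_M m h)

lemma two_mul_M_le (m : ℕ → ℕ) (hm : ∀ k, 2 ≤ m k) (k : ℕ) : 2 * M m k ≤ M m (k + 1) :=
  Nat.mul_le_mul_right _ (hm k)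

lemma digit_eq_zero_of_lt (m : ℕ → ℕ) (hm : ∀ k, 2 ≤ m k) {n k r : ℕ} (hn : n < M m r)
    (hk : r ≤ k) : digit m n k = 0 := by
  simp [digit, Nat.div_eq_of_lt (hn.trans_le (M_mono m hm hk))]

lemma digit_block_of_lt (m : ℕ → ℕ) (hm : ∀ k, 2 ≤ m k) (q i : ℕ) {k r : ℕ} (hk : k < r) :
    digit m (q * M m r + i) k = digit m i k := by
  obtain ⟨t, ht⟩ := M_dvd_M m (Nat.succ_le_of_lt hk)
  have : q * M m r + i = i + M m k * (m k * (t * q)) := by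
    rw [ht]; simp only [M]; ring
  rw [digit, digit, this, Nat.add_mul_div_left _ _ (M_pos m hm k), Nat.add_mul_mod_self_left]

lemma digit_block_self (m : ℕ → ℕ) (hm : ∀ k, 2 ≤ m k) {q i r : ℕ} (hi : i < M m r)
    (hq : q < m r) : digit m (q * M m r + i) r = q := by
  rw [digit, add_comm, Nat.add_mul_div_right _ _ (M_pos m hm r), Nat.div_eq_of_lt hi, zero_add,
    Nat.mod_eq_of_lt hq]

lemma block_lt (m : ℕ → ℕ) {q i r : ℕ} (hi : i < M m r) (hq : q < m r) :
    q * M m r + i < M m (r + 1) := by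
  have := Nat.mul_le_mul_right (M m r) (Nat.succ_le_of_lt hq)
  rw [Nat.succ_mul] at this
  exact (Nat.add_lt_add_left hi _).trans_le this

/-! ### Rademacher and Vilenkin functions -/

section
variable (m : ℕ → ℕ) [∀ k, NeZero (m k)]

lemma rademacher_eq (k : ℕ) (x : Group m) : rademacher m k x = ZMod.stdAddChar (x k) := by
  rw [rademacher, ZMod.stdAddChar_apply, ZMod.toCircle_apply]

lemma rademacher_add (k : ℕ) (x y : Group m) :
    rademacher m k (x + y) = rademacher m k x * rademacher m k y := by
  simp [rademacher_eq, AddChar.map_add_eq_mul]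

lemma norm_rademacher (k : ℕ) (x : Group m) : ‖rademacher m k x‖ = 1 := by
  rw [rademacher_eq, ZMod.stdAddChar_apply, Circle.norm_coe]

lemma rademacher_ne_zero (k : ℕ) (x : Group m) : rademacher m k x ≠ 0 := by
  rw [← norm_ne_zero_iff, norm_rademacher]; exact one_ne_zero

@[fun_prop]
lemma continuous_rademacher (k : ℕ) : Continuous (rademacher m k) := by
  have : rademacher m k = (fun t : ZMod (m k) => ZMod.stdAddChar t) ∘ fun x : Group m => x k := by
    ext x; exact rademacher_eq m k x
  rw [this]
  exact continuous_of_discreteTopology.comp (continuous_apply k)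

@[fun_prop]
lemma continuous_psi (n : ℕ) : Continuous (psi m n) := by
  unfold psi; fun_prop

lemma psi_add (n : ℕ) (x y : Group m) : psi m n (x + y) = psi m n x * psi m n y := by
  simp [psi, rademacher_add, mul_pow, Finset.prod_mul_distrib]

lemma norm_psi (n : ℕ) (x : Group m) : ‖psi m n x‖ = 1 := by
  simp [psi, norm_rademacher]

lemma psi_ne_zero (n : ℕ) (x : Group m) : psi m n x ≠ 0 := by
  rw [← norm_ne_zero_iff, norm_psi]; exact one_ne_zero

omit [∀ k, NeZero (m k)] in
lemma psi_zero_left (x : Group m) : psi m 0 x = 1 := by simp [psi]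

lemma psi_zero_right (n : ℕ) : psi m n 0 = 1 := by
  have := psi_add m n 0 0
  rw [add_zero] at this
  exact (mul_eq_left₀ (psi_ne_zero m n 0)).1 this.symm

lemma psi_mul_conj (n : ℕ) (x : Group m) : psi m n x * starRingEnd ℂ (psi m n x) = 1 := by
  rw [Complex.mul_conj, Complex.normSq_eq_norm_sq, norm_psi]; simp

lemma psi_neg (n : ℕ) (x : Group m) : psi m n (-x) = starRingEnd ℂ (psi m n x) := by
  have h := psi_add m n x (-x)
  rw [add_neg_cancel, psi_zero_right, ← psi_mul_conj m n x] at h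
  exact (mul_left_cancel₀ (psi_ne_zero m n x) h).symm

lemma psi_sub (n : ℕ) (x y : Group m) :
    psi m n (x - y) = psi m n x * starRingEnd ℂ (psi m n y) := by
  rw [sub_eq_add_neg, psi_add, psi_neg]

variable (hm : ∀ k, 2 ≤ m k)
include hm

omit [∀ k, NeZero (m k)] in
lemma psi_eq_prod_range {n r : ℕ} (hn : n < M m r) (x : Group m) :
    psi m n x = ∏ k ∈ Finset.range r, rademacher m k x ^ digit m n k := by
  rcases le_total n r with h | h
  · refine Finset.prod_subset (Finset.range_mono h) fun k _ hk => ?_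
    rw [digit_eq_zero m hm (by simpa using hk), pow_zero]
  · refine (Finset.prod_subset (Finset.range_mono h) fun k _ hk => ?_).symm
    rw [digit_eq_zero_of_lt m hm hn (by simpa using hk), pow_zero]

omit [∀ k, NeZero (m k)] in
lemma psi_block {q i r : ℕ} (hi : i < M m r) (hq : q < m r) (x : Group m) :
    psi m (q * M m r + i) x = rademacher m r x ^ q * psi m i x := by
  rw [psi_eq_prod_range m hm (block_lt m hi hq), Finset.prod_range_succ,
    digit_block_self m hm hi hq, psi_eq_prod_range m hm hi, mul_comm]
  congr 1
  exact Finset.prod_congr rfl fun k hk => by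
    rw [digit_block_of_lt m hm q i (Finset.mem_range.1 hk)]

lemma psi_eq_one_of_mem_cyl {n r : ℕ} (hn : n < M m r) {x : Group m} (hx : x ∈ cyl m r) :
    psi m n x = 1 := by
  rw [psi_eq_prod_range m hm hn]
  refine Finset.prod_eq_one fun k hk => ?_
  rw [rademacher_eq, hx k (Finset.mem_range.1 hk), AddChar.map_zero_eq_one, one_pow]

omit hm in
omit [∀ k, NeZero (m k)] in
lemma single_mem_cyl (r : ℕ) (t : ZMod (m r)) : (Pi.single r t : Group m) ∈ cyl m r :=
  fun _ hi => Pi.single_eq_of_ne (M := fun k => ZMod (m k)) hi.ne t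

omit [∀ k, NeZero (m k)] in
lemma exists_block {n r : ℕ} (hn : n < M m (r + 1)) :
    ∃ q i, q < m r ∧ i < M m r ∧ n = q * M m r + i := by
  refine ⟨n / M m r, n % M m r, ?_, Nat.mod_lt _ (M_pos m hm r), ?_⟩
  · exact Nat.div_lt_of_lt_mul (by rwa [mul_comm])
  · rw [mul_comm]; exact (Nat.div_add_mod _ _).symm

lemma isPrimitiveRoot_rademacher_single (r : ℕ) :
    IsPrimitiveRoot (rademacher m r (Pi.single r 1)) (m r) := by
  have h := Complex.isPrimitiveRoot_exp (m r) (NeZero.ne _)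
  have : Fact (1 < m r) := ⟨hm r⟩
  convert h using 1
  simp [rademacher, ZMod.val_one]

/-- At the point whose only nonzero coordinate is x_r = 1 all lower characters equal 1 and r_r is a
primitive root of unity, so the top digit is determined there; induction recovers the rest. -/
lemma psi_injective_of_lt (r : ℕ) : ∀ n n' : ℕ, n < M m r → n' < M m r →
    psi m n = psi m n' → n = n' := by
  induction r with
  | zero =>
    intro n n' hn hn' _
    simp only [M] at hn hn'
    omega
  | succ r ih =>
    intro n n' hn hn' h
    obtain ⟨q, i, hq, hi, rfl⟩ := exists_block m hm hn
    obtain ⟨q', i', hq', hi', rfl⟩ := exists_block m hm hn'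
    have hqq : q = q' := by
      have h1 := congrFun h (Pi.single r 1)
      rw [psi_block m hm hi hq, psi_block m hm hi' hq',
        psi_eq_one_of_mem_cyl m hm hi (single_mem_cyl m r 1),
        psi_eq_one_of_mem_cyl m hm hi' (single_mem_cyl m r 1), mul_one, mul_one] at h1
      exact (isPrimitiveRoot_rademacher_single m hm r).pow_inj hq hq' h1
    subst hqq
    rw [ih i i' hi hi' (funext fun x => ?_)]
    have h1 := congrFun h x
    rw [psi_block m hm hi hq, psi_block m hm hi' hq] at h1
    exact mul_left_cancel₀ (pow_ne_zero _ (rademacher_ne_zero m r x)) h1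

lemma integral_psi_mul_conj (n n' : ℕ) :
    ∫ x, psi m n x * starRingEnd ℂ (psi m n' x) ∂(haar m) = if n = n' then 1 else 0 := by
  split_ifs with h
  · subst h; simp [psi_mul_conj]
  · have : ∃ y, psi m n y ≠ psi m n' y := by
      by_contra! hc
      refine h (psi_injective_of_lt m hm (max n n') n n'
        ((le_max_left _ _).trans_lt (lt_M m hm _)) ((le_max_right _ _).trans_lt (lt_M m hm _))
        (funext hc))
    obtain ⟨y, hy⟩ := this
    -- Translation by y multiplies the integral by a number different from 1, so it vanishes.
    have h1 := integral_add_left_eq_self (μ := haar m)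
      (fun x => psi m n x * starRingEnd ℂ (psi m n' x)) y
    simp only [psi_add, map_mul] at h1
    have h2 : ∀ x, psi m n y * psi m n x * (starRingEnd ℂ (psi m n' y) * starRingEnd ℂ (psi m n' x))
        = (psi m n y * starRingEnd ℂ (psi m n' y)) *
          (psi m n x * starRingEnd ℂ (psi m n' x)) := fun x => by ring
    simp only [h2, integral_const_mul] at h1
    by_contra hne
    have h3 := mul_eq_right₀ hne |>.1 h1
    apply hy
    rw [← psi_mul_conj m n' y] at h3
    have hc : starRingEnd ℂ (psi m n' y) ≠ 0 := by simpa using psi_ne_zero m n' y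
    exact mul_right_cancel₀ hc h3

end

/-! ### Dirichlet kernels -/

/-- The Dirichlet kernel `D_n = ∑_{i < n} ψ_i`. -/
def dirichlet (m : ℕ → ℕ) (n : ℕ) (x : Group m) : ℂ := ∑ i ∈ Finset.range n, psi m i x

section
variable (m : ℕ → ℕ) [∀ k, NeZero (m k)]

@[fun_prop]
lemma continuous_dirichlet (n : ℕ) : Continuous (dirichlet m n) := by
  unfold dirichlet; fun_prop

omit [∀ k, NeZero (m k)] in
lemma dirichlet_zero (x : Group m) : dirichlet m 0 x = 0 := by simp [dirichlet]

variable (hm : ∀ k, 2 ≤ m k)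
include hm

omit [∀ k, NeZero (m k)] in
lemma dirichlet_block {q i r : ℕ} (hi : i ≤ M m r) (hq : q < m r) (x : Group m) :
    dirichlet m (q * M m r + i) x =
      dirichlet m (q * M m r) x + rademacher m r x ^ q * dirichlet m i x := by
  simp only [dirichlet]
  rw [Finset.sum_range_add, Finset.mul_sum]
  congr 1
  exact Finset.sum_congr rfl fun j hj =>
    psi_block m hm ((Finset.mem_range.1 hj).trans_le hi) hq x

lemma dirichlet_mul_M {q r : ℕ} (hq : q ≤ m r) (x : Group m) :
    dirichlet m (q * M m r) x =
      dirichlet m (M m r) x * ∑ s ∈ Finset.range q, rademacher m r x ^ s := by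
  induction q with
  | zero => simp [dirichlet]
  | succ q ih =>
    rw [Nat.succ_mul, dirichlet_block m hm le_rfl hq, ih (by omega), Finset.sum_range_succ]
    ring

omit hm in
lemma sum_stdAddChar_pow {n : ℕ} [NeZero n] (t : ZMod n) :
    ∑ q ∈ Finset.range n, (ZMod.stdAddChar t : ℂ) ^ q = if t = 0 then (n : ℂ) else 0 := by
  split_ifs with h
  · simp [h]
  · have h1 : (ZMod.stdAddChar t : ℂ) ≠ 1 := fun h' =>
      h (ZMod.injective_stdAddChar (by rw [h', AddChar.map_zero_eq_one]))
    rw [geom_sum_eq h1, ← AddChar.map_nsmul_eq_pow]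
    simp

open Classical in
lemma dirichlet_M (r : ℕ) (x : Group m) :
    dirichlet m (M m r) x = if x ∈ cyl m r then (M m r : ℂ) else 0 := by
  induction r with
  | zero => simp [dirichlet, M, cyl, psi]
  | succ r ih =>
    have h : M m (r + 1) = m r * M m r := rfl
    have h2 : x ∈ cyl m (r + 1) ↔ x ∈ cyl m r ∧ x r = 0 := by
      simp only [cyl, Set.mem_ofPred_eq, Nat.lt_succ_iff_lt_or_eq, or_imp, forall_and, forall_eq]
    rw [h, dirichlet_mul_M m hm le_rfl, ih]
    simp only [rademacher_eq, sum_stdAddChar_pow, h2]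
    split_ifs with h1 h3 h4 h5 <;> first | (exfalso; tauto) | skip
    · push_cast; ring
    all_goals simp

lemma integral_dirichlet {n : ℕ} (hn : 0 < n) : ∫ x, dirichlet m n x ∂(haar m) = 1 := by
  have h := fun i => integral_psi_mul_conj m hm i 0
  simp only [psi_zero_left, map_one, mul_one] at h
  simp only [dirichlet]
  rw [integral_finsetSum]
  · simp [h, hn]
  · exact fun i _ => (continuous_psi m i).integrable_of_hasCompactSupport
      (HasCompactSupport.of_compactSpace _)

/-- The k-th digit of M_r - 1 - i is m_k - 1 - i_k: the subtraction involves no borrowing. -/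
lemma psi_reflect (r : ℕ) : ∀ i, i < M m r → ∀ x : Group m,
    psi m (M m r - 1 - i) x = psi m (M m r - 1) x * starRingEnd ℂ (psi m i x) := by
  induction r with
  | zero =>
    intro i hi x
    simp only [M, Nat.lt_one_iff] at hi
    simp [hi, M, psi_zero_left]
  | succ r ih =>
    intro n hn x
    obtain ⟨q, i, hq, hi, rfl⟩ := exists_block m hm hn
    have h0 := M_pos m hm r
    have hM : M m (r + 1) = m r * M m r := rfl
    obtain ⟨d, hd⟩ := Nat.exists_eq_add_of_lt hq
    have e1 : M m (r + 1) - 1 - (q * M m r + i) = d * M m r + (M m r - 1 - i) := by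
      have : M m (r + 1) = d * M m r + M m r + q * M m r := by rw [hM, hd]; ring
      omega
    have e2 : M m (r + 1) - 1 = (q + d) * M m r + (M m r - 1) := by
      have : M m (r + 1) = (q + d) * M m r + M m r := by rw [hM, hd]; ring
      omega
    rw [e1, e2, psi_block m hm (by omega) (by omega), psi_block m hm (by omega) (by omega),
      psi_block m hm hi hq, ih i hi, map_mul, map_pow, pow_add]
    have : rademacher m r x ^ q * starRingEnd ℂ (rademacher m r x) ^ q = 1 := by
      rw [← mul_pow, Complex.mul_conj, Complex.normSq_eq_norm_sq, norm_rademacher]; simp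
    linear_combination (-(rademacher m r x ^ d * psi m (M m r - 1) x *
      starRingEnd ℂ (psi m i x))) * this

/-- The last i characters below M_r are, by `psi_reflect`, the conjugates of the first i up to one
common unimodular factor. -/
lemma dirichlet_reflect {r i : ℕ} (hi : i ≤ M m r) (x : Group m) :
    dirichlet m (M m r - i) x =
      dirichlet m (M m r) x - psi m (M m r - 1) x * starRingEnd ℂ (dirichlet m i x) := by
  induction i with
  | zero => simp [dirichlet]
  | succ i ih =>
    have h := ih (by omega)
    have e : M m r - i = M m r - (i + 1) + 1 := by omega
    have e' : M m r - (i + 1) = M m r - 1 - i := by omega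
    rw [dirichlet, e, Finset.sum_range_succ, ← dirichlet, e', psi_reflect m hm r i (by omega)] at h
    rw [e', eq_sub_of_add_eq h]
    simp only [dirichlet, Finset.sum_range_succ, map_add]
    ring

end

/-! ### The `L¹` norm of continuous kernels -/

section
variable {X : Type*} [TopologicalSpace X] [CompactSpace X] [MeasurableSpace X]

/-- The `L¹` norm of a kernel. -/
def l1 (μ : Measure X) (K : X → ℂ) : ℝ := ∫ z, ‖K z‖ ∂μ

omit [TopologicalSpace X] [CompactSpace X] in
lemma l1_nonneg (μ : Measure X) (K : X → ℂ) : 0 ≤ l1 μ K := integral_nonneg fun _ => norm_nonneg _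

omit [TopologicalSpace X] [CompactSpace X] in
lemma l1_congr_norm (μ : Measure X) {K L : X → ℂ} (h : ∀ z, ‖K z‖ = ‖L z‖) : l1 μ K = l1 μ L := by
  simp only [l1, h]

omit [TopologicalSpace X] [CompactSpace X] in
lemma l1_const_mul (μ : Measure X) (c : ℂ) (K : X → ℂ) :
    l1 μ (fun z => c * K z) = ‖c‖ * l1 μ K := by
  simp only [l1, norm_mul, integral_const_mul]

variable [OpensMeasurableSpace X] (μ : Measure X) [IsFiniteMeasure μ]

lemma integrable_of_continuous {E : Type*} [NormedAddCommGroup E] {K : X → E}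
    (hK : Continuous K) : Integrable K μ :=
  hK.integrable_of_hasCompactSupport (HasCompactSupport.of_compactSpace _)

lemma l1_add_le {K L : X → ℂ} (hK : Continuous K) (hL : Continuous L) :
    l1 μ (fun z => K z + L z) ≤ l1 μ K + l1 μ L := by
  unfold l1
  rw [← integral_add (integrable_of_continuous μ hK.norm) (integrable_of_continuous μ hL.norm)]
  exact integral_mono (integrable_of_continuous μ (by fun_prop))
    (integrable_of_continuous μ (by fun_prop)) fun z => norm_add_le _ _

lemma l1_sub_le {K L : X → ℂ} (hK : Continuous K) (hL : Continuous L) :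
    l1 μ (fun z => K z - L z) ≤ l1 μ K + l1 μ L := by
  have h := l1_add_le μ hK hL.neg
  simp only [Pi.neg_apply, ← sub_eq_add_neg] at h
  rwa [show l1 μ (-L) = l1 μ L from l1_congr_norm μ fun z => norm_neg (L z)] at h

lemma l1_sum_le {ι : Type*} (s : Finset ι) {K : ι → X → ℂ} (hK : ∀ i ∈ s, Continuous (K i)) :
    l1 μ (fun z => ∑ i ∈ s, K i z) ≤ ∑ i ∈ s, l1 μ (K i) := by
  unfold l1
  rw [← integral_finsetSum _ fun i hi => integrable_of_continuous μ (hK i hi).norm]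
  exact integral_mono
    (integrable_of_continuous μ (continuous_finsetSum s fun i hi => hK i hi).norm)
    (integrable_of_continuous μ (continuous_finsetSum s fun i hi => (hK i hi).norm))
    fun z => norm_sum_le _ _

/-- Averaging over a finite cyclic group of translations which leave `‖G‖` invariant. -/
lemma l1_geom_sum_mul [AddGroup X] [MeasurableAdd X] [μ.IsAddLeftInvariant]
    {n : ℕ} [NeZero n] (φ : X → ZMod n) (hφ : Continuous φ) (e : ZMod n → X)
    (he : ∀ t z, φ (e t + z) = t + φ z) {G : X → ℂ} (hG : Continuous G)
    (hGe : ∀ t z, ‖G (e t + z)‖ = ‖G z‖) :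
    l1 μ (fun z => (∑ s ∈ Finset.range n, (ZMod.stdAddChar (φ z) : ℂ) ^ s) * G z) = l1 μ G := by
  set H : ZMod n → ℝ := fun t => ‖∑ s ∈ Finset.range n, (ZMod.stdAddChar t : ℂ) ^ s‖ with hH
  have hn : (n : ℝ) ≠ 0 := Nat.cast_ne_zero.2 (NeZero.ne n)
  have hcont : ∀ t, Continuous fun z => H (t + φ z) * ‖G z‖ := fun t =>
    ((continuous_of_discreteTopology (f := H)).comp (hφ.const_add t)).mul hG.norm
  -- H equals n at 0 and vanishes elsewhere, so its sum over any translate of the cyclic group is n.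
  have hsum : ∀ u, ∑ t, H (t + u) = n := fun u => by
    rw [Fintype.sum_equiv (Equiv.addRight u) (fun t => H (t + u)) H fun _ => rfl,
      Finset.sum_eq_single 0]
    · simp [hH]
    · intro t _ ht
      rw [hH]; simp only
      rw [sum_stdAddChar_pow, if_neg ht, norm_zero]
    · simp
  have hinv : ∀ t, ∫ z, H (t + φ z) * ‖G z‖ ∂μ = ∫ z, H (φ z) * ‖G z‖ ∂μ := fun t => by
    rw [← integral_add_left_eq_self (μ := μ) (fun z => H (φ z) * ‖G z‖) (e t)]
    simp only [he, hGe]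
  have key : (n : ℝ) * ∫ z, H (φ z) * ‖G z‖ ∂μ = n * ∫ z, ‖G z‖ ∂μ := by
    calc (n : ℝ) * ∫ z, H (φ z) * ‖G z‖ ∂μ = ∑ t : ZMod n, ∫ z, H (t + φ z) * ‖G z‖ ∂μ := by
          simp [hinv]
      _ = ∫ z, ∑ t : ZMod n, H (t + φ z) * ‖G z‖ ∂μ :=
          (integral_finsetSum _ fun t _ => integrable_of_continuous μ (hcont t)).symm
      _ = n * ∫ z, ‖G z‖ ∂μ := by
          simp only [← Finset.sum_mul, hsum, integral_const_mul]
  have := mul_left_cancel₀ hn key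
  simpa only [l1, norm_mul] using this

end

/-! ### The Fejér and Marcinkiewicz kernels -/

/-- The sum `∑_{i < L} D_i` of Dirichlet kernels, an unnormalized Fejér kernel. -/
def fejer (m : ℕ → ℕ) (L : ℕ) (x : Group m) : ℂ := ∑ i ∈ Finset.range L, dirichlet m i x

/-- The unnormalized Marcinkiewicz kernel `∑_{i < L} D_i ⊗ D_i`. -/
def marcinkiewicz (m : ℕ → ℕ) (L : ℕ) (z : Group m × Group m) : ℂ :=
  ∑ i ∈ Finset.range L, dirichlet m i z.1 * dirichlet m i z.2

/-- A bound for the growth of sequences satisfying recursions along the blocks `[qM_r, (q+1)M_r)`. -/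
lemma le_of_block_recursion (m : ℕ → ℕ) (hm : ∀ k, 2 ≤ m k) {B : ℕ} (hB : ∀ k, m k ≤ B)
    {a : ℕ → ℝ} {C : ℝ} (hC : 0 ≤ C) (h0 : a 0 = 0) (h1 : a 1 = 0)
    (hblock : ∀ r q L, q < m r → L ≤ M m r →
      a (q * M m r + L) ≤ a (q * M m r) + (C * M m r + a L))
    (hfull : ∀ r, a (M m (r + 1)) ≤ a (M m r) + C * M m r)
    (r L : ℕ) (hL : L ≤ M m r) : a L ≤ (2 * B + 1) * C * M m r := by
  have two (r : ℕ) : (2 : ℝ) * M m r ≤ M m (r + 1) := by exact_mod_cast two_mul_M_le m hm r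
  -- The coefficient 1 of a (M_r) in `hfull` is essential: as M_r at least doubles, the increments C
  -- M_r sum geometrically.
  have hM (r : ℕ) : a (M m r) ≤ C * M m r := by
    induction r with
    | zero => simp [M, h1, hC]
    | succ r ih =>
      have := mul_le_mul_of_nonneg_left (two r) hC
      linarith [hfull r]
  have hqM (r q : ℕ) (hq : q ≤ m r) : a (q * M m r) ≤ q * (2 * C * M m r) := by
    induction q with
    | zero => simp [h0]
    | succ q ih =>
      have := hblock r q (M m r) hq le_rfl
      rw [Nat.succ_mul]
      push_cast
      linarith [ih (by omega), hM r]
  induction r generalizing L with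
  | zero =>
    simp only [M] at hL ⊢
    have : a L = 0 := by interval_cases L <;> assumption
    rw [this]; positivity
  | succ r ih =>
    have hnn : 0 ≤ C * M m r := by positivity
    have htwo := mul_le_mul_of_nonneg_left (two r) hC
    have hB0 : (0 : ℝ) ≤ B := Nat.cast_nonneg B
    rcases hL.eq_or_lt with rfl | hL
    · have h2 := hM (r + 1)
      have : 0 ≤ 2 * B * (C * M m (r + 1)) := by positivity
      linarith
    · obtain ⟨q, i, hq, hi, rfl⟩ := exists_block m hm hL
      have h2 := hblock r q i hq hi.le
      have h3 := hqM r q hq.le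
      have h4 := ih i hi.le
      have h5 : (q : ℝ) ≤ B := by exact_mod_cast hq.le.trans (hB r)
      have h6 : (q : ℝ) * (2 * C * M m r) ≤ B * (2 * C * M m r) :=
        mul_le_mul_of_nonneg_right h5 (by positivity)
      have h7 := mul_le_mul_of_nonneg_left htwo (by positivity : (0 : ℝ) ≤ 2 * B + 1)
      linarith

section
variable (m : ℕ → ℕ) [∀ k, NeZero (m k)]

@[fun_prop]
lemma continuous_fejer (n : ℕ) : Continuous (fejer m n) := by
  unfold fejer; fun_prop

@[fun_prop]
lemma continuous_marcinkiewicz (n : ℕ) : Continuous (marcinkiewicz m n) := by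
  unfold marcinkiewicz; fun_prop

lemma l1_tensor (K L : Group m → ℂ) :
    l1 (haar₂ m) (fun z => K z.1 * L z.2) = l1 (haar m) K * l1 (haar m) L := by
  simp only [l1, norm_mul]
  exact integral_prod_mul (μ := haar m) (ν := haar m) (fun x => ‖K x‖) (fun y => ‖L y‖)

variable (hm : ∀ k, 2 ≤ m k)
include hm

lemma l1_dirichlet_M (r : ℕ) : l1 (haar m) (dirichlet m (M m r)) = 1 := by
  have h := integral_dirichlet m hm (M_pos m hm r)
  have h2 : ∀ x, dirichlet m (M m r) x = (‖dirichlet m (M m r) x‖ : ℂ) := fun x => by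
    rw [dirichlet_M m hm]; split_ifs <;> simp
  rw [integral_congr_ae (Filter.Eventually.of_forall h2), integral_complex_ofReal] at h
  exact_mod_cast h

lemma l1_dirichlet_mul_M {r q : ℕ} (hq : q ≤ m r) :
    l1 (haar m) (dirichlet m (q * M m r)) ≤ q := by
  have h : dirichlet m (q * M m r) = fun x =>
      ∑ s ∈ Finset.range q, rademacher m r x ^ s * dirichlet m (M m r) x := by
    ext x; rw [dirichlet_mul_M m hm hq, ← Finset.sum_mul, mul_comm]
  rw [h]
  refine (l1_sum_le _ _ fun i _ => by fun_prop).trans ?_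
  have h2 (s : ℕ) : l1 (haar m) (fun x => rademacher m r x ^ s * dirichlet m (M m r) x) = 1 := by
    rw [← l1_dirichlet_M m hm r]
    exact l1_congr_norm _ fun x => by simp [norm_rademacher]
  simp [h2]

lemma fejer_block {q L r : ℕ} (hL : L ≤ M m r) (hq : q < m r) (x : Group m) :
    fejer m (q * M m r + L) x = fejer m (q * M m r) x +
      (L * dirichlet m (q * M m r) x + rademacher m r x ^ q * fejer m L x) := by
  simp only [fejer]
  rw [Finset.sum_range_add, Finset.sum_congr rfl fun i hi =>
    dirichlet_block m hm ((Finset.mem_range.1 hi).le.trans hL) hq x, Finset.sum_add_distrib,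
    Finset.mul_sum]
  simp

lemma fejer_mul_M {q r : ℕ} (hq : q ≤ m r) (x : Group m) :
    fejer m (q * M m r) x = ∑ s ∈ Finset.range q, M m r * dirichlet m (s * M m r) x +
      (∑ s ∈ Finset.range q, rademacher m r x ^ s) * fejer m (M m r) x := by
  induction q with
  | zero => simp [fejer]
  | succ q ih =>
    rw [Nat.succ_mul, fejer_block m hm le_rfl hq, ih (by omega), Finset.sum_range_succ,
      Finset.sum_range_succ]
    ring

lemma marcinkiewicz_block {q L r : ℕ} (hL : L ≤ M m r) (hq : q < m r) (z : Group m × Group m) :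
    marcinkiewicz m (q * M m r + L) z = marcinkiewicz m (q * M m r) z +
      ((L * (dirichlet m (q * M m r) z.1 * dirichlet m (q * M m r) z.2) +
        dirichlet m (q * M m r) z.1 * (rademacher m r z.2 ^ q * fejer m L z.2) +
        (rademacher m r z.1 ^ q * fejer m L z.1) * dirichlet m (q * M m r) z.2) +
        (rademacher m r z.1 * rademacher m r z.2) ^ q * marcinkiewicz m L z) := by
  have h (i : ℕ) (hi : i ∈ Finset.range L) :
      dirichlet m (q * M m r + i) z.1 * dirichlet m (q * M m r + i) z.2 =
        dirichlet m (q * M m r) z.1 * dirichlet m (q * M m r) z.2 +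
        dirichlet m (q * M m r) z.1 * (rademacher m r z.2 ^ q * dirichlet m i z.2) +
        (rademacher m r z.1 ^ q * dirichlet m i z.1) * dirichlet m (q * M m r) z.2 +
        (rademacher m r z.1 * rademacher m r z.2) ^ q *
          (dirichlet m i z.1 * dirichlet m i z.2) := by
    have hi' := (Finset.mem_range.1 hi).le.trans hL
    rw [dirichlet_block m hm hi' hq, dirichlet_block m hm hi' hq]
    ring
  simp only [marcinkiewicz, fejer]
  rw [Finset.sum_range_add, Finset.sum_congr rfl h]
  simp only [Finset.sum_add_distrib, Finset.mul_sum, Finset.sum_mul, Finset.sum_const,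
    Finset.card_range, nsmul_eq_mul]

lemma marcinkiewicz_mul_M {q r : ℕ} (hq : q ≤ m r) (z : Group m × Group m) :
    marcinkiewicz m (q * M m r) z = ∑ s ∈ Finset.range q,
        (M m r * (dirichlet m (s * M m r) z.1 * dirichlet m (s * M m r) z.2) +
        dirichlet m (s * M m r) z.1 * (rademacher m r z.2 ^ s * fejer m (M m r) z.2) +
        (rademacher m r z.1 ^ s * fejer m (M m r) z.1) * dirichlet m (s * M m r) z.2) +
      (∑ s ∈ Finset.range q, (rademacher m r z.1 * rademacher m r z.2) ^ s) *
        marcinkiewicz m (M m r) z := by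
  induction q with
  | zero => simp [marcinkiewicz]
  | succ q ih =>
    rw [Nat.succ_mul, marcinkiewicz_block m hm le_rfl hq, ih (by omega), Finset.sum_range_succ,
      Finset.sum_range_succ]
    ring

lemma dirichlet_cyl_add {i r : ℕ} (hi : i ≤ M m r) {u : Group m} (hu : u ∈ cyl m r)
    (x : Group m) : dirichlet m i (u + x) = dirichlet m i x :=
  Finset.sum_congr rfl fun j hj => by
    rw [psi_add, psi_eq_one_of_mem_cyl m hm ((Finset.mem_range.1 hj).trans_le hi) hu, one_mul]

lemma fejer_cyl_add {L r : ℕ} (hL : L ≤ M m r) {u : Group m} (hu : u ∈ cyl m r)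
    (x : Group m) : fejer m L (u + x) = fejer m L x :=
  Finset.sum_congr rfl fun _ hj =>
    dirichlet_cyl_add m hm ((Finset.mem_range.1 hj).le.trans hL) hu x

lemma marcinkiewicz_cyl_add {L r : ℕ} (hL : L ≤ M m r) {u : Group m} (hu : u ∈ cyl m r)
    (z : Group m × Group m) : marcinkiewicz m L ((0, u) + z) = marcinkiewicz m L z :=
  Finset.sum_congr rfl fun j hj => by
    simp only [Prod.fst_add, Prod.snd_add, zero_add]
    rw [dirichlet_cyl_add m hm ((Finset.mem_range.1 hj).le.trans hL) hu]

lemma l1_geom_sum_mul_fejer (r : ℕ) :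
    l1 (haar m) (fun x => (∑ s ∈ Finset.range (m r), rademacher m r x ^ s) * fejer m (M m r) x) =
      l1 (haar m) (fejer m (M m r)) := by
  simp only [rademacher_eq]
  refine l1_geom_sum_mul (haar m) (fun x => x r) (continuous_apply r) (fun t => Pi.single r t)
    (fun t z => ?_) (by fun_prop) fun t z => ?_
  · simp
  · rw [fejer_cyl_add m hm le_rfl (single_mem_cyl m r t)]

/-- The geometric sum depends only on the sum of the two r-th coordinates, so translating the second
variable alone is enough for the averaging. -/
lemma l1_geom_sum_mul_marcinkiewicz (r : ℕ) :
    l1 (haar₂ m) (fun z => (∑ s ∈ Finset.range (m r),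
      (rademacher m r z.1 * rademacher m r z.2) ^ s) * marcinkiewicz m (M m r) z) =
      l1 (haar₂ m) (marcinkiewicz m (M m r)) := by
  simp only [rademacher_eq, ← AddChar.map_add_eq_mul]
  refine l1_geom_sum_mul (haar₂ m) (fun z => z.1 r + z.2 r) (by fun_prop)
    (fun t => (0, Pi.single r t)) (fun t z => ?_) (by fun_prop) fun t z => ?_
  · simp; ring
  · rw [marcinkiewicz_cyl_add m hm le_rfl (single_mem_cyl m r t)]

variable {B : ℕ} (hB : ∀ k, m k ≤ B)
include hB

/-- The block recursion applies with C = B²: the new terms are at most B Dirichlet kernels D_{sM_r},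
each of norm at most B and with weight at most M_r. -/
lemma l1_fejer_le (r L : ℕ) (hL : L ≤ M m r) :
    l1 (haar m) (fejer m L) ≤ (2 * B + 1) * (B : ℝ) ^ 2 * M m r := by
  have hB1 : (1 : ℝ) ≤ B := by exact_mod_cast (show 1 ≤ B by linarith [hm 0, hB 0])
  have hq' {q r : ℕ} (hq : q < m r) : (q : ℝ) ≤ B := by exact_mod_cast hq.le.trans (hB r)
  refine le_of_block_recursion m hm hB (a := fun L => l1 (haar m) (fejer m L)) (by positivity)
    ?_ ?_ (fun r q L hq hL => ?_) (fun r => ?_) r L hL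
  · simp [fejer, l1]
  · simp [fejer, l1, dirichlet]
  · rw [funext (fejer_block m hm hL hq)]
    refine (l1_add_le _ (by fun_prop) (by fun_prop)).trans (add_le_add_right ?_ _)
    refine (l1_add_le _ (by fun_prop) (by fun_prop)).trans (add_le_add ?_ (le_of_eq ?_))
    · rw [l1_const_mul, Complex.norm_natCast]
      have h1 := (l1_dirichlet_mul_M m hm hq.le).trans (hq' hq)
      have h2 : (L : ℝ) ≤ M m r := by exact_mod_cast hL
      calc (L : ℝ) * l1 (haar m) (dirichlet m (q * M m r)) ≤ M m r * B := by
            have := l1_nonneg (haar m) (dirichlet m (q * M m r))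
            gcongr
        _ ≤ M m r * (B : ℝ) ^ 2 := by gcongr; nlinarith
        _ = _ := by ring
    · exact l1_congr_norm _ fun x => by simp [norm_rademacher]
  · have h : M m (r + 1) = m r * M m r := rfl
    rw [h, funext (fejer_mul_M m hm le_rfl), add_comm (l1 _ _)]
    refine (l1_add_le _ (by fun_prop) (by fun_prop)).trans
      (add_le_add ?_ (l1_geom_sum_mul_fejer m hm r).le)
    refine (l1_sum_le _ _ fun i _ => by fun_prop).trans ?_
    have h3 : ∀ s ∈ Finset.range (m r),
        l1 (haar m) (fun x => (M m r : ℂ) * dirichlet m (s * M m r) x) ≤ M m r * B := by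
      intro s hs
      rw [l1_const_mul, Complex.norm_natCast]
      gcongr
      exact (l1_dirichlet_mul_M m hm (Finset.mem_range.1 hs).le).trans (hq' (Finset.mem_range.1 hs))
    refine (Finset.sum_le_card_nsmul _ _ _ h3).trans ?_
    rw [Finset.card_range, nsmul_eq_mul]
    have h4 : (m r : ℝ) ≤ B := by exact_mod_cast hB r
    calc (m r : ℝ) * (M m r * B) ≤ B * (M m r * B) := by gcongr
      _ = _ := by ring

/-- Every cross term is a tensor product with a factor D_{qM_r} of norm at most B; the other factor
is again such a kernel or a Fejér sum, so the one-variable estimate suffices. -/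
lemma l1_marcinkiewicz_cross_le {q r L : ℕ} (hq : q < m r) (hL : L ≤ M m r) :
    l1 (haar₂ m) (fun z => L * (dirichlet m (q * M m r) z.1 * dirichlet m (q * M m r) z.2) +
        dirichlet m (q * M m r) z.1 * (rademacher m r z.2 ^ q * fejer m L z.2) +
        (rademacher m r z.1 ^ q * fejer m L z.1) * dirichlet m (q * M m r) z.2) ≤
      ((B : ℝ) ^ 2 + 2 * B * ((2 * B + 1) * (B : ℝ) ^ 2)) * M m r := by
  have h1 := (l1_dirichlet_mul_M m hm hq.le).trans
    (show (q : ℝ) ≤ B by exact_mod_cast hq.le.trans (hB r))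
  have h2 := l1_fejer_le m hm hB r L hL
  have hL' : (L : ℝ) ≤ M m r := by exact_mod_cast hL
  have h3 : l1 (haar m) (fun x => rademacher m r x ^ q * fejer m L x) = l1 (haar m) (fejer m L) :=
    l1_congr_norm _ fun x => by simp [norm_rademacher]
  refine (l1_add_le _ (by fun_prop) (by fun_prop)).trans ?_
  refine (add_le_add_left (l1_add_le _ (by fun_prop) (by fun_prop)) _).trans ?_
  rw [l1_const_mul, l1_tensor, Complex.norm_natCast,
    l1_tensor m (fun x => rademacher m r x ^ q * fejer m L x),
    l1_tensor m _ (fun x => rademacher m r x ^ q * fejer m L x), h3]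
  have n1 := l1_nonneg (haar m) (dirichlet m (q * M m r))
  have n2 := l1_nonneg (haar m) (fejer m L)
  calc _ ≤ (M m r : ℝ) * (B * B) + B * ((2 * B + 1) * (B : ℝ) ^ 2 * M m r) +
        ((2 * B + 1) * (B : ℝ) ^ 2 * M m r) * B := by gcongr
    _ = _ := by ring

/-- A constant for the `L¹` norms of the Marcinkiewicz kernels. -/
def marcinkiewiczConst (B : ℕ) : ℝ :=
  (2 * B + 1) * (B * ((B : ℝ) ^ 2 + 2 * B * ((2 * B + 1) * (B : ℝ) ^ 2)))

lemma l1_marcinkiewicz_le (r L : ℕ) (hL : L ≤ M m r) :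
    l1 (haar₂ m) (marcinkiewicz m L) ≤ marcinkiewiczConst B * M m r := by
  have hB1 : (1 : ℝ) ≤ B := by exact_mod_cast (show 1 ≤ B by linarith [hm 0, hB 0])
  refine le_of_block_recursion m hm hB (a := fun L => l1 (haar₂ m) (marcinkiewicz m L))
    (by positivity) ?_ ?_ (fun r q L hq hL => ?_) (fun r => ?_) r L hL
  · simp [marcinkiewicz, l1]
  · simp [marcinkiewicz, l1, dirichlet]
  · rw [funext (marcinkiewicz_block m hm hL hq)]
    refine (l1_add_le _ (by fun_prop) (by fun_prop)).trans (add_le_add_right ?_ _)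
    refine (l1_add_le _ (by fun_prop) (by fun_prop)).trans (add_le_add ?_ (le_of_eq ?_))
    · refine (l1_marcinkiewicz_cross_le m hm hB hq hL).trans ?_
      gcongr
      exact le_mul_of_one_le_left (by positivity) hB1
    · exact l1_congr_norm _ fun x => by simp [norm_rademacher]
  · have h : M m (r + 1) = m r * M m r := rfl
    rw [h, funext (marcinkiewicz_mul_M m hm le_rfl), add_comm (l1 _ _)]
    refine (l1_add_le _ (by fun_prop) (by fun_prop)).trans
      (add_le_add ?_ (l1_geom_sum_mul_marcinkiewicz m hm r).le)
    refine (l1_sum_le _ _ fun i _ => by fun_prop).trans ?_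
    refine (Finset.sum_le_card_nsmul _ _ _ fun s hs =>
      l1_marcinkiewicz_cross_le m hm hB (Finset.mem_range.1 hs) le_rfl).trans ?_
    rw [Finset.card_range, nsmul_eq_mul, mul_assoc (B : ℝ)]
    gcongr
    exact_mod_cast hB r

end

/-! ### Cesàro numbers -/

lemma cesaroNumber_zero (a : ℝ) : cesaroNumber a 0 = 1 := by simp [cesaroNumber]

lemma cesaroNumber_succ (a : ℝ) (n : ℕ) :
    cesaroNumber a (n + 1) = (1 + a / (n + 1)) * cesaroNumber a n := by
  have h : (n.factorial : ℝ) ≠ 0 := by positivity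
  have h' : (n + 1 : ℝ) ≠ 0 := by positivity
  rw [cesaroNumber, cesaroNumber, Finset.prod_range_succ, Nat.factorial_succ]
  push_cast
  field_simp
  ring

lemma cesaroNumber_sub_one_succ (a : ℝ) (n : ℕ) :
    cesaroNumber (a - 1) (n + 1) = a / (n + 1) * cesaroNumber a n := by
  have h : (n.factorial : ℝ) ≠ 0 := by positivity
  have h' : (n + 1 : ℝ) ≠ 0 := by positivity
  rw [cesaroNumber, cesaroNumber, Finset.prod_range_succ', Nat.factorial_succ]
  have : ∀ i : ℕ, a - 1 + ((i + 1 : ℕ) + 1) = a + (i + 1 : ℝ) := fun i => by push_cast; ring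
  simp only [this]
  push_cast
  field_simp
  ring

lemma sum_cesaroNumber (a : ℝ) (n : ℕ) :
    ∑ i ∈ Finset.range (n + 1), cesaroNumber (a - 1) i = cesaroNumber a n := by
  induction n with
  | zero => simp [cesaroNumber_zero]
  | succ n ih =>
    rw [Finset.sum_range_succ, ih, cesaroNumber_sub_one_succ, cesaroNumber_succ]
    ring

section
variable {α : ℝ} (hα₀ : 0 < α) (hα₁ : α < 1)
include hα₀ hα₁

lemma cesaroNumber_neg_pos (n : ℕ) : 0 < cesaroNumber (-α) n := by
  induction n with
  | zero => simp [cesaroNumber_zero]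
  | succ n ih =>
    rw [cesaroNumber_succ]
    refine mul_pos ?_ ih
    have : α / (n + 1) < 1 := by
      rw [div_lt_one (by positivity)]; linarith [(Nat.cast_nonneg n : (0 : ℝ) ≤ n)]
    rw [neg_div]; linarith

lemma cesaroNumber_neg_antitone : Antitone (cesaroNumber (-α)) := by
  refine antitone_nat_of_succ_le fun n => ?_
  rw [cesaroNumber_succ, neg_div]
  refine mul_le_of_le_one_left (cesaroNumber_neg_pos hα₀ hα₁ n).le ?_
  have : 0 ≤ α / (n + 1) := by positivity
  linarith

lemma cesaroNumber_neg_le_one (n : ℕ) : cesaroNumber (-α) n ≤ 1 := by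
  rw [← cesaroNumber_zero (-α)]
  exact cesaroNumber_neg_antitone hα₀ hα₁ (Nat.zero_le n)

/-- With x = α/(n+1), Bernoulli's inequality reduces the induction step to (1-x)(1+x) ≤ 1. -/
lemma cesaroNumber_neg_le (n : ℕ) : cesaroNumber (-α) n ≤ ((n : ℝ) + 1) ^ (-α) := by
  induction n with
  | zero => simp [cesaroNumber_zero]
  | succ n ih =>
    have hn : (0 : ℝ) < n + 1 := by positivity
    have h1 : (1 + 1 / ((n : ℝ) + 1)) ^ α ≤ 1 + α * (1 / (n + 1)) :=
      rpow_one_add_le_one_add_mul_self (by linarith [show 0 ≤ 1 / ((n : ℝ) + 1) by positivity])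
        hα₀.le hα₁.le
    have h2 : (1 + -α / ((n : ℝ) + 1)) * (1 + 1 / ((n : ℝ) + 1)) ^ α ≤ 1 := by
      have h3 : 0 ≤ 1 + -α / ((n : ℝ) + 1) := by
        rw [neg_div, ← sub_eq_add_neg, sub_nonneg, div_le_one hn]
        linarith [(Nat.cast_nonneg n : (0 : ℝ) ≤ n)]
      refine (mul_le_mul_of_nonneg_left h1 h3).trans ?_
      have : (1 + -α / ((n : ℝ) + 1)) * (1 + α * (1 / (n + 1))) = 1 - (α / (n + 1)) ^ 2 := by ring
      rw [this]
      linarith [sq_nonneg (α / ((n : ℝ) + 1))]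
    have h4 : ((n : ℝ) + 1 + 1) = (n + 1) * (1 + 1 / ((n : ℝ) + 1)) := by field_simp
    have h5 : (0 : ℝ) < (1 + 1 / ((n : ℝ) + 1)) ^ α := by positivity
    rw [cesaroNumber_succ]
    push_cast
    rw [h4, Real.mul_rpow hn.le (by positivity), Real.rpow_neg (by positivity : (0 : ℝ) ≤ 1 + _),
      ← div_eq_mul_inv, le_div_iff₀ h5]
    calc _ = ((1 + -α / ((n : ℝ) + 1)) * (1 + 1 / ((n : ℝ) + 1)) ^ α) * cesaroNumber (-α) n := by
          ring
      _ ≤ 1 * cesaroNumber (-α) n :=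
          mul_le_mul_of_nonneg_right h2 (cesaroNumber_neg_pos hα₀ hα₁ n).le
      _ ≤ _ := by rwa [one_mul]

/-- The induction starts from A_1^{-α} = 1 - α; the step is Bernoulli's inequality for
((n+1)/(n+2))^α. -/
lemma le_cesaroNumber_neg_succ (n : ℕ) :
    (1 - α) * ((n : ℝ) + 1) ^ (-α) ≤ cesaroNumber (-α) (n + 1) := by
  induction n with
  | zero => simp [cesaroNumber_succ, cesaroNumber_zero, sub_eq_add_neg]
  | succ n ih =>
    have hn : (0 : ℝ) < n + 1 := by positivity
    have hn2 : (0 : ℝ) < n + 1 + 1 := by positivity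
    have h1 : (1 + -(1 / ((n : ℝ) + 1 + 1))) ^ α ≤ 1 + α * -(1 / (n + 1 + 1)) := by
      refine rpow_one_add_le_one_add_mul_self ?_ hα₀.le hα₁.le
      rw [neg_le_neg_iff, div_le_one hn2]
      linarith
    have h4 : 1 + -(1 / ((n : ℝ) + 1 + 1)) = (n + 1) / (n + 1 + 1) := by field_simp; ring
    rw [h4, Real.div_rpow hn.le hn2.le] at h1
    rw [cesaroNumber_succ]
    push_cast
    have h5 : ((n : ℝ) + 1 + 1) ^ (-α) =
        ((n : ℝ) + 1) ^ α / ((n : ℝ) + 1 + 1) ^ α * ((n : ℝ) + 1) ^ (-α) := by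
      rw [Real.rpow_neg hn.le, Real.rpow_neg hn2.le]
      have := Real.rpow_pos_of_pos hn α
      field_simp
    have h6 : 1 + -α / ((n : ℝ) + 1 + 1) = 1 + α * -(1 / (n + 1 + 1)) := by ring
    rw [h5, h6]
    calc _ = ((n : ℝ) + 1) ^ α / ((n : ℝ) + 1 + 1) ^ α * ((1 - α) * ((n : ℝ) + 1) ^ (-α)) := by ring
      _ ≤ _ := mul_le_mul h1 ih (mul_nonneg (by linarith) (by positivity))
        (le_trans (by positivity) h1)

lemma inv_cesaroNumber_neg_le {N : ℕ} (hN : 1 ≤ N) :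
    1 / cesaroNumber (-α) (N - 1) ≤ (1 - α)⁻¹ * (N : ℝ) ^ α := by
  have h1 : 0 < 1 - α := by linarith
  have hN0 : (0 : ℝ) < N := by exact_mod_cast hN
  have h : (1 - α) * (N : ℝ) ^ (-α) ≤ cesaroNumber (-α) (N - 1) := by
    obtain ⟨n, rfl⟩ := Nat.exists_eq_add_of_le' hN
    cases n with
    | zero => simp [cesaroNumber_zero, hα₀.le]
    | succ n =>
      refine le_trans ?_ (le_cesaroNumber_neg_succ hα₀ hα₁ n)
      refine mul_le_mul_of_nonneg_left ?_ h1.le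
      exact Real.rpow_le_rpow_of_nonpos (by positivity) (by push_cast; linarith) (by linarith)
  have h2 : 0 < (1 - α) * (N : ℝ) ^ (-α) := by positivity
  refine (one_div_le_one_div_of_le h2 h).trans (le_of_eq ?_)
  rw [Real.rpow_neg hN0.le]
  field_simp

/-- The absolute values of the negative Cesàro numbers `A_i^{-α-1}`, `i ≥ 1`. -/
lemma neg_cesaroNumber_succ_le (i : ℕ) :
    -cesaroNumber (-α - 1) (i + 1) ≤ ((i : ℝ) + 1) ^ (-1 - α) := by
  rw [cesaroNumber_sub_one_succ]
  have h := cesaroNumber_neg_le hα₀ hα₁ i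
  have hi : (0 : ℝ) < i + 1 := by positivity
  have h2 : ((i : ℝ) + 1) ^ (-1 - α) = 1 / (i + 1) * ((i : ℝ) + 1) ^ (-α) := by
    rw [sub_eq_add_neg, Real.rpow_add hi, Real.rpow_neg_one, one_div]
  rw [h2, neg_div, neg_mul, neg_neg]
  have := (cesaroNumber_neg_pos hα₀ hα₁ i).le
  gcongr

lemma neg_cesaroNumber_succ_nonneg (i : ℕ) : 0 ≤ -cesaroNumber (-α - 1) (i + 1) := by
  have := (cesaroNumber_neg_pos hα₀ hα₁ i).le
  rw [cesaroNumber_sub_one_succ, neg_div, neg_mul, neg_neg]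
  positivity

lemma neg_cesaroNumber_succ_antitone :
    Antitone fun i => -cesaroNumber (-α - 1) (i + 1) := by
  refine antitone_nat_of_succ_le fun n => ?_
  simp only [cesaroNumber_sub_one_succ (-α), neg_div, neg_mul, neg_neg]
  have h1 := (cesaroNumber_neg_pos hα₀ hα₁ n).le
  have h2 := cesaroNumber_neg_antitone hα₀ hα₁ (Nat.le_succ n)
  have h3 := (cesaroNumber_neg_pos hα₀ hα₁ (n + 1)).le
  push_cast
  gcongr
  linarith

end

/-! ### Abel summation in the `L¹` norm -/

section
variable {X : Type*} [TopologicalSpace X] [CompactSpace X] [MeasurableSpace X]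
  [OpensMeasurableSpace X] (μ : Measure X) [IsFiniteMeasure μ]

lemma l1_sum_by_parts_le (u : ℕ → ℝ) {G : ℕ → X → ℂ} (hG : ∀ i, Continuous (G i)) (L : ℕ) :
    l1 μ (fun z => ∑ i ∈ Finset.range L, u i * G i z) ≤
      |u (L - 1)| * l1 μ (fun z => ∑ i ∈ Finset.range L, G i z) +
      ∑ i ∈ Finset.range (L - 1), |u (i + 1) - u i| *
        l1 μ (fun z => ∑ j ∈ Finset.range (i + 1), G j z) := by
  have h : (fun z => ∑ i ∈ Finset.range L, (u i : ℂ) * G i z) = fun z =>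
      (u (L - 1) : ℂ) * ∑ i ∈ Finset.range L, G i z - ∑ i ∈ Finset.range (L - 1),
        ((u (i + 1) - u i : ℝ) : ℂ) * ∑ j ∈ Finset.range (i + 1), G j z := by
    ext z
    simpa using Finset.sum_range_by_parts (fun i => (u i : ℂ)) (fun i => G i z) L
  rw [h]
  refine (l1_sub_le μ (by fun_prop) (by fun_prop)).trans (add_le_add (le_of_eq ?_) ?_)
  · rw [l1_const_mul, Complex.norm_real, Real.norm_eq_abs]
  · refine (l1_sum_le μ _ fun i _ => by fun_prop).trans (Finset.sum_le_sum fun i _ => le_of_eq ?_)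
    rw [l1_const_mul, Complex.norm_real, Real.norm_eq_abs]

/-- The bound C n on the partial sums is what constant terms of size C would give, so undoing the
summation by parts with constant terms yields C ∑ u_i. -/
lemma l1_sum_mul_le_of_antitone {u : ℕ → ℝ} (hu : Antitone u) (hu0 : ∀ i, 0 ≤ u i)
    {G : ℕ → X → ℂ} (hG : ∀ i, Continuous (G i)) {C : ℝ}
    (hC : ∀ n, l1 μ (fun z => ∑ i ∈ Finset.range n, G i z) ≤ C * n) (L : ℕ) :
    l1 μ (fun z => ∑ i ∈ Finset.range L, u i * G i z) ≤ C * ∑ i ∈ Finset.range L, u i := by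
  refine (l1_sum_by_parts_le μ u hG L).trans ?_
  have h := Finset.sum_range_by_parts u (fun _ => (1 : ℝ)) L
  simp only [smul_eq_mul, mul_one, Finset.sum_const, Finset.card_range, nsmul_eq_mul] at h
  rw [h, sub_eq_add_neg, ← Finset.sum_neg_distrib, mul_add, Finset.mul_sum, abs_of_nonneg (hu0 _)]
  refine add_le_add ?_ (Finset.sum_le_sum fun i _ => ?_)
  · calc _ ≤ u (L - 1) * (C * L) := mul_le_mul_of_nonneg_left (hC L) (hu0 _)
      _ = _ := by ring
  · have h1 : u (i + 1) - u i ≤ 0 := sub_nonpos.2 (hu (Nat.le_succ i))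
    rw [abs_of_nonpos h1]
    calc _ ≤ -(u (i + 1) - u i) * (C * (i + 1 : ℕ)) :=
          mul_le_mul_of_nonneg_left (hC _) (by linarith)
      _ = _ := by ring

/-- The boundary term and the telescoping sum of increments each contribute at most C times the last
weight. -/
lemma l1_sum_mul_le_of_monotoneOn {u : ℕ → ℝ} {L : ℕ} (hL : 0 < L)
    (hu : ∀ i, i + 1 < L → u i ≤ u (i + 1))
    (hu0 : ∀ i < L, 0 ≤ u i) {G : ℕ → X → ℂ} (hG : ∀ i, Continuous (G i)) {C : ℝ}
    (hC : ∀ n ≤ L, l1 μ (fun z => ∑ i ∈ Finset.range n, G i z) ≤ C) :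
    l1 μ (fun z => ∑ i ∈ Finset.range L, u i * G i z) ≤ 2 * C * u (L - 1) := by
  have hC0 : 0 ≤ C := (l1_nonneg μ _).trans (hC 0 (Nat.zero_le _))
  refine (l1_sum_by_parts_le μ u hG L).trans ?_
  rw [abs_of_nonneg (hu0 _ (by omega))]
  have h : ∀ i ∈ Finset.range (L - 1), |u (i + 1) - u i| *
      l1 μ (fun z => ∑ j ∈ Finset.range (i + 1), G j z) ≤ (u (i + 1) - u i) * C := by
    intro i hi
    have hi' := Finset.mem_range.1 hi
    have h1 := sub_nonneg.2 (hu i (by omega))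
    rw [abs_of_nonneg h1]
    exact mul_le_mul_of_nonneg_left (hC _ (by omega)) h1
  have h2 := Finset.sum_le_sum h
  rw [← Finset.sum_mul, Finset.sum_range_sub] at h2
  have h3 := mul_le_mul_of_nonneg_left (hC L le_rfl) (hu0 (L - 1) (by omega))
  have h4 := mul_nonneg (hu0 0 hL) hC0
  linarith

lemma l1_sum_Ico_mul_le_of_monotoneOn {u : ℕ → ℝ} {a b : ℕ} (ha : 0 < a) (hab : a ≤ b)
    (hu : ∀ i, i + 1 < b → u i ≤ u (i + 1)) (hu0 : ∀ i < b, 0 ≤ u i) {G : ℕ → X → ℂ}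
    (hG : ∀ i, Continuous (G i)) {C : ℝ}
    (hC : ∀ n ≤ b, l1 μ (fun z => ∑ i ∈ Finset.range n, G i z) ≤ C) :
    l1 μ (fun z => ∑ i ∈ Finset.Ico a b, u i * G i z) ≤ 4 * C * u (b - 1) := by
  have hC0 : 0 ≤ C := (l1_nonneg μ _).trans (hC 0 (Nat.zero_le _))
  -- A difference of two initial sums, each costing twice the last weight; hence the constant 4.
  simp only [Finset.sum_Ico_eq_sub _ hab]
  refine (l1_sub_le μ (by fun_prop) (by fun_prop)).trans ?_
  have h1 := l1_sum_mul_le_of_monotoneOn μ (ha.trans_le hab) hu hu0 hG hC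
  have h2 := l1_sum_mul_le_of_monotoneOn μ ha (fun i hi => hu i (by omega))
    (fun i hi => hu0 i (by omega)) hG (fun n hn => hC n (hn.trans hab))
  have mono : ∀ c, a - 1 ≤ c → c < b → u (a - 1) ≤ u c := by
    intro c hc
    induction c, hc using Nat.le_induction with
    | base => exact fun _ => le_rfl
    | succ c _ ih => exact fun hcb => (ih (by omega)).trans (hu c hcb)
  have h3 := mul_le_mul_of_nonneg_left (mono (b - 1) (by omega) (by omega))
    (by positivity : 0 ≤ 2 * C)
  linarith

end

lemma exists_M_le_lt (m : ℕ → ℕ) (hm : ∀ k, 2 ≤ m k) {n : ℕ} (hn : 0 < n) :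
    ∃ r, M m r ≤ n ∧ n < M m (r + 1) := by
  have h : ∃ r, n < M m r := ⟨n, lt_M m hm n⟩
  classical
  have h1 := Nat.find_spec h
  have h2 : Nat.find h ≠ 0 := by
    intro h0
    rw [h0] at h1
    simp only [M] at h1
    omega
  obtain ⟨r, hr⟩ := Nat.exists_eq_succ_of_ne_zero h2
  refine ⟨r, ?_, by rwa [hr] at h1⟩
  have := Nat.find_min h (m := r) (by omega)
  omega

/-- Choosing M_r ≤ n < M_{r+1} gives M_{r+1} ≤ B n; the boundedness of m costs only the factor B. -/
lemma le_linear_of_le_M (m : ℕ → ℕ) (hm : ∀ k, 2 ≤ m k) {B : ℕ} (hB : ∀ k, m k ≤ B)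
    {a : ℕ → ℝ} (ha : a 0 = 0) {C : ℝ} (hC : 0 ≤ C) (h : ∀ r L, L ≤ M m r → a L ≤ C * M m r)
    (n : ℕ) : a n ≤ C * B * n := by
  rcases Nat.eq_zero_or_pos n with rfl | hn
  · simp [ha]
  · obtain ⟨r, h1, h2⟩ := exists_M_le_lt m hm hn
    refine (h (r + 1) n h2.le).trans ?_
    have h3 : M m (r + 1) ≤ B * n := Nat.mul_le_mul (hB r) h1
    rw [mul_assoc]
    gcongr
    exact_mod_cast h3

/-! ### Kernels with Cesàro weights -/

section
variable (m : ℕ → ℕ) [∀ k, NeZero (m k)] (hm : ∀ k, 2 ≤ m k) {B : ℕ} (hB : ∀ k, m k ≤ B)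
  {α : ℝ} (hα₀ : 0 < α) (hα₁ : α < 1)
include hα₀ hα₁

lemma l1_sum_cesaroNumber_mul_le {X : Type*} [TopologicalSpace X] [CompactSpace X]
    [MeasurableSpace X] [OpensMeasurableSpace X] (μ : Measure X) [IsFiniteMeasure μ]
    {G : ℕ → X → ℂ} (hG : ∀ i, Continuous (G i)) (hG0 : ∀ z, G 0 z = 0) {C : ℝ} (hC0 : 0 ≤ C)
    (hC : ∀ n, l1 μ (fun z => ∑ i ∈ Finset.range n, G i z) ≤ C * n) (L : ℕ) :
    l1 μ (fun z => ∑ i ∈ Finset.range L, cesaroNumber (-α - 1) i * G i z) ≤ 2 * C := by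
  -- Truncated subtraction makes u 0 = u 1 = α. The true weight A_0^{-α-1} = 1 has the opposite
  -- sign, but it multiplies G 0 = 0, so it may be replaced to keep u antitone and nonnegative.
  set u : ℕ → ℝ := fun i => -cesaroNumber (-α - 1) (i - 1 + 1) with hu
  have hu1 : Antitone u := fun i j hij =>
    neg_cesaroNumber_succ_antitone hα₀ hα₁ (Nat.sub_le_sub_right hij 1)
  have hu0 : ∀ i, 0 ≤ u i := fun i => neg_cesaroNumber_succ_nonneg hα₀ hα₁ _
  have h := l1_sum_mul_le_of_antitone μ hu1 hu0 hG hC L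
  have e : l1 μ (fun z => ∑ i ∈ Finset.range L, u i * G i z) =
      l1 μ (fun z => ∑ i ∈ Finset.range L, cesaroNumber (-α - 1) i * G i z) := by
    refine l1_congr_norm μ fun z => ?_
    rw [← norm_neg, ← Finset.sum_neg_distrib]
    congr 1
    refine Finset.sum_congr rfl fun i _ => ?_
    cases i with
    | zero => simp [hG0]
    | succ i => simp [hu]
  rw [e] at h
  refine h.trans ?_
  rw [mul_comm]
  gcongr
  -- The sum equals α + 1 - A_L^{-α}.
  have h1 : ∑ i ∈ Finset.range (L + 1), u i ≤ 2 := by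
    rw [Finset.sum_range_succ']
    have h2 := sum_cesaroNumber (-α) L
    rw [Finset.sum_range_succ', cesaroNumber_zero] at h2
    have h3 : ∑ i ∈ Finset.range L, u (i + 1) =
        -∑ i ∈ Finset.range L, cesaroNumber (-α - 1) (i + 1) := by
      rw [← Finset.sum_neg_distrib]; rfl
    have h4 : u 0 = α := by
      simp [hu, cesaroNumber_sub_one_succ, cesaroNumber_zero]
    rw [h3, h4]
    linarith [cesaroNumber_neg_pos hα₀ hα₁ L]
  rw [Finset.sum_range_succ] at h1
  linarith [hu0 L]

include hm hB

lemma l1_sum_cesaroNumber_dirichlet_le (L : ℕ) :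
    l1 (haar m) (fun x => ∑ i ∈ Finset.range L, cesaroNumber (-α - 1) i * dirichlet m i x) ≤
      2 * ((2 * B + 1) * (B : ℝ) ^ 2 * B) :=
  l1_sum_cesaroNumber_mul_le hα₀ hα₁ (haar m) (G := fun i => dirichlet m i)
    (fun i => continuous_dirichlet m i) (dirichlet_zero m) (by positivity)
    (le_linear_of_le_M m hm hB (a := fun n => l1 (haar m) (fejer m n)) (by simp [fejer, l1])
      (by positivity) (l1_fejer_le m hm hB)) L

omit hm hB hα₀ hα₁ [∀ k, NeZero (m k)] in
lemma marcinkiewiczConst_nonneg (B : ℕ) : 0 ≤ marcinkiewiczConst B := by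
  unfold marcinkiewiczConst; positivity

lemma l1_sum_cesaroNumber_dirichlet_tensor_le (L : ℕ) :
    l1 (haar₂ m) (fun z => ∑ i ∈ Finset.range L,
      cesaroNumber (-α - 1) i * (dirichlet m i z.1 * dirichlet m i z.2)) ≤
      2 * (marcinkiewiczConst B * B) :=
  l1_sum_cesaroNumber_mul_le hα₀ hα₁ (haar₂ m)
    (G := fun i z => dirichlet m i z.1 * dirichlet m i z.2)
    (fun i => by fun_prop) (fun z => by simp [dirichlet_zero])
    (mul_nonneg (marcinkiewiczConst_nonneg B) (Nat.cast_nonneg B))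
    (le_linear_of_le_M m hm hB (a := fun n => l1 (haar₂ m) (marcinkiewicz m n))
      (by simp [marcinkiewicz, l1]) (marcinkiewiczConst_nonneg B) (l1_marcinkiewicz_le m hm hB)) L

omit hm hB in
lemma abs_sum_cesaroNumber_le (L : ℕ) :
    |∑ i ∈ Finset.range L, cesaroNumber (-α - 1) i| ≤ 1 := by
  cases L with
  | zero => simp
  | succ L =>
    rw [sum_cesaroNumber, abs_of_pos (cesaroNumber_neg_pos hα₀ hα₁ L)]
    exact cesaroNumber_neg_le_one hα₀ hα₁ L

/-- A constant for the `L¹` norms of the upper parts of the Cesàro kernels. -/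
def upperKernelConst (B : ℕ) : ℝ :=
  1 + 2 * (2 * ((2 * B + 1) * (B : ℝ) ^ 2 * B)) + 2 * (marcinkiewiczConst B * B)

/-- Reflecting both factors gives four terms: D ⊗ D with coefficient ∑ w_i, two mixed tensors with
the weighted Dirichlet sum W, and the conjugate of the weighted sum V of D_i ⊗ D_i. All are bounded,
since D = D_{M_k} has norm 1. -/
lemma l1_upper_kernel_le {k L : ℕ} (hL : L ≤ M m k + 1) :
    l1 (haar₂ m) (fun z => ∑ i ∈ Finset.range L, cesaroNumber (-α - 1) i *
      (dirichlet m (M m k - i) z.1 * dirichlet m (M m k - i) z.2)) ≤ upperKernelConst B := by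
  set w := cesaroNumber (-α - 1)
  set D := dirichlet m (M m k) with hD
  set ψ := psi m (M m k - 1)
  set W : Group m → ℂ := fun x => ∑ i ∈ Finset.range L, w i * dirichlet m i x with hW
  set V : Group m × Group m → ℂ := fun z =>
    ∑ i ∈ Finset.range L, w i * (dirichlet m i z.1 * dirichlet m i z.2) with hV
  have e : ∀ z : Group m × Group m, ∑ i ∈ Finset.range L, (w i : ℂ) *
      (dirichlet m (M m k - i) z.1 * dirichlet m (M m k - i) z.2) =
      ((((∑ i ∈ Finset.range L, w i : ℝ) : ℂ) * (D z.1 * D z.2) -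
        D z.1 * (ψ z.2 * starRingEnd ℂ (W z.2))) - (ψ z.1 * starRingEnd ℂ (W z.1)) * D z.2) +
        ψ z.1 * ψ z.2 * starRingEnd ℂ (V z) := by
    intro z
    have h : ∀ i ∈ Finset.range L, (w i : ℂ) *
        (dirichlet m (M m k - i) z.1 * dirichlet m (M m k - i) z.2) =
        ((w i * (D z.1 * D z.2) - D z.1 * (ψ z.2 * (w i * starRingEnd ℂ (dirichlet m i z.2)))) -
        (ψ z.1 * (w i * starRingEnd ℂ (dirichlet m i z.1))) * D z.2) +
        ψ z.1 * ψ z.2 * (w i * (starRingEnd ℂ (dirichlet m i z.1) *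
          starRingEnd ℂ (dirichlet m i z.2))) := by
      intro i hi
      have hi' : i ≤ M m k := by have := Finset.mem_range.1 hi; omega
      rw [dirichlet_reflect m hm hi', dirichlet_reflect m hm hi']
      ring
    rw [Finset.sum_congr rfl h]
    simp only [hW, hV, map_sum, map_mul, Complex.conj_ofReal, Complex.ofReal_sum,
      Finset.sum_add_distrib, Finset.sum_sub_distrib, Finset.mul_sum, Finset.sum_mul]
  have hWc : Continuous W := by fun_prop
  have hVc : Continuous V := by fun_prop
  have hDc : Continuous D := continuous_dirichlet m _
  have hψc : Continuous ψ := continuous_psi m _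
  have hconj : Continuous (starRingEnd ℂ) := Complex.continuous_conj
  rw [funext e]
  have nW : l1 (haar m) (fun x => ψ x * starRingEnd ℂ (W x)) = l1 (haar m) W :=
    l1_congr_norm _ fun x => by rw [norm_mul, norm_psi, one_mul, RCLike.norm_conj]
  have nV : l1 (haar₂ m) (fun z => ψ z.1 * ψ z.2 * starRingEnd ℂ (V z)) = l1 (haar₂ m) V :=
    l1_congr_norm _ fun x => by
      rw [norm_mul, norm_mul, norm_psi, norm_psi, one_mul, one_mul, RCLike.norm_conj]
  have h1 := l1_sum_cesaroNumber_dirichlet_le m hm hB hα₀ hα₁ L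
  have h2 := l1_sum_cesaroNumber_dirichlet_tensor_le m hm hB hα₀ hα₁ L
  have h3 := abs_sum_cesaroNumber_le hα₀ hα₁ L
  have hD1 : l1 (haar m) D = 1 := l1_dirichlet_M m hm k
  refine (l1_add_le _ (by fun_prop) (by fun_prop)).trans ?_
  refine (add_le_add_left ((l1_sub_le _ (by fun_prop) (by fun_prop)).trans
    (add_le_add_left (l1_sub_le _ (by fun_prop) (by fun_prop)) _)) _).trans ?_
  rw [nV, l1_const_mul, l1_tensor, l1_tensor m D (fun x => ψ x * starRingEnd ℂ (W x)),
    l1_tensor m (fun x => ψ x * starRingEnd ℂ (W x)) D, nW, hD1, Complex.norm_real,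
    Real.norm_eq_abs]
  unfold upperKernelConst
  linarith

lemma l1_lower_kernel_le {n r : ℕ} (hr : r < n) :
    l1 (haar₂ m) (fun z => ∑ j ∈ Finset.Ico (M m r) (M m (r + 1)),
      cesaroNumber (-α - 1) (M m (n + 1) - j) * (dirichlet m j z.1 * dirichlet m j z.2)) ≤
      16 * marcinkiewiczConst B * B * M m r * (M m (n + 1) : ℝ) ^ (-1 - α) := by
  set N := M m (n + 1) with hN
  set b := M m (r + 1) with hb
  have hbn : b ≤ M m n := M_mono m hm hr
  have hbN : 2 * b ≤ N := (Nat.mul_le_mul_left 2 hbn).trans (two_mul_M_le m hm n)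
  have hb0 : 0 < b := M_pos m hm _
  set u : ℕ → ℝ := fun j => -cesaroNumber (-α - 1) (N - j) with hu
  -- Here N - j ≥ 1, so the exceptional positive weight A_0^{-α-1} does not occur.
  have hu' (j : ℕ) (hj : j < b) : u j = -cesaroNumber (-α - 1) (N - j - 1 + 1) := by
    rw [hu, Nat.sub_add_cancel (by omega)]
  have h := l1_sum_Ico_mul_le_of_monotoneOn (haar₂ m) (u := u)
    (G := fun i z => dirichlet m i z.1 * dirichlet m i z.2) (M_pos m hm r)
    (M_mono m hm (Nat.le_add_right r 1))
    (fun i hi => by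
      rw [hu' i (by omega), hu' (i + 1) hi]
      exact neg_cesaroNumber_succ_antitone hα₀ hα₁ (by omega))
    (fun i hi => by
      rw [hu' i hi]
      exact neg_cesaroNumber_succ_nonneg hα₀ hα₁ _)
    (fun i => by fun_prop) (fun L hL => l1_marcinkiewicz_le m hm hB (r + 1) L hL)
  have e : l1 (haar₂ m) (fun z => ∑ j ∈ Finset.Ico (M m r) b,
      u j * (dirichlet m j z.1 * dirichlet m j z.2)) =
      l1 (haar₂ m) (fun z => ∑ j ∈ Finset.Ico (M m r) b,
      cesaroNumber (-α - 1) (N - j) * (dirichlet m j z.1 * dirichlet m j z.2)) := by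
    refine l1_congr_norm _ fun z => ?_
    rw [← norm_neg, ← Finset.sum_neg_distrib]
    congr 1
    exact Finset.sum_congr rfl fun j _ => by simp [hu]
  rw [e] at h
  refine h.trans ?_
  have hN0 : (0 : ℝ) < N := by exact_mod_cast M_pos m hm (n + 1)
  -- As 2b ≤ N, the index N - (b - 1) is at least N/2; the constant is 2^{1+α} ≤ 4.
  have h1 : u (b - 1) ≤ 4 * (N : ℝ) ^ (-1 - α) := by
    rw [hu' _ (by omega)]
    refine (neg_cesaroNumber_succ_le hα₀ hα₁ _).trans ?_
    have h2 : (N : ℝ) / 2 ≤ ((N - (b - 1) - 1 : ℕ) : ℝ) + 1 := by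
      rw [div_le_iff₀ two_pos]
      have : N ≤ (N - (b - 1) - 1 + 1) * 2 := by omega
      exact_mod_cast this
    refine (Real.rpow_le_rpow_of_nonpos (by positivity) h2 (by linarith)).trans ?_
    rw [Real.div_rpow hN0.le two_pos.le, div_eq_inv_mul, ← Real.rpow_neg two_pos.le]
    gcongr
    calc (2 : ℝ) ^ (-(-1 - α)) ≤ (2 : ℝ) ^ (2 : ℝ) :=
          Real.rpow_le_rpow_of_exponent_le one_le_two (by linarith)
      _ = 4 := by norm_num
  have h3 : (b : ℝ) ≤ B * M m r := by
    exact_mod_cast Nat.mul_le_mul_right (M m r) (hB r)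
  have h4 := marcinkiewiczConst_nonneg B
  have h5 : 0 ≤ u (b - 1) := by
    rw [hu' _ (by omega)]
    exact neg_cesaroNumber_succ_nonneg hα₀ hα₁ _
  calc 4 * (marcinkiewiczConst B * b) * u (b - 1)
      ≤ 4 * (marcinkiewiczConst B * (B * M m r)) * (4 * (N : ℝ) ^ (-1 - α)) := by gcongr
    _ = _ := by ring

end

/-! ### Integral operators on `L^p` -/

/-- Jensen's inequality for a not necessarily normalized weight `k`. -/
lemma lintegral_mul_enorm_rpow_le {X : Type*} [MeasurableSpace X] {μ : Measure X} {k : X → ℝ≥0∞}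
    (hk : Measurable k) (hk' : ∀ x, k x < ∞) {g : X → ℂ} (hg : AEStronglyMeasurable g μ)
    {q : ℝ} (hq : 1 ≤ q) :
    (∫⁻ w, k w * ‖g w‖ₑ ∂μ) ^ q ≤
      (∫⁻ w, k w * ‖g w‖ₑ ^ q ∂μ) * (∫⁻ w, k w ∂μ) ^ (q - 1) := by
  have hq0 : 0 < q := one_pos.trans_le hq
  -- Jensen's inequality is the comparison of the L¹ and L^q norms for the measure with density k.
  have h := eLpNorm_le_eLpNorm_mul_rpow_measure_univ (p := 1) (q := ENNReal.ofReal q)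
    (by simpa using ENNReal.ofReal_le_ofReal hq)
    (hg.mono_ac (withDensity_absolutelyContinuous μ k))
  have hdens := lintegral_withDensity_eq_lintegral_mul_non_measurable μ hk
    (Filter.Eventually.of_forall hk')
  rw [eLpNorm_one_eq_lintegral_enorm, eLpNorm_eq_lintegral_rpow_enorm_toReal (by simpa using hq0)
    ENNReal.ofReal_ne_top, ENNReal.toReal_ofReal hq0.le, hdens, hdens,
    withDensity_apply _ MeasurableSet.univ, Measure.restrict_univ] at h
  have h2 := ENNReal.rpow_le_rpow h hq0.le
  rw [ENNReal.mul_rpow_of_nonneg _ _ hq0.le, ← ENNReal.rpow_mul, ← ENNReal.rpow_mul,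
    one_div_mul_cancel hq0.ne', ENNReal.rpow_one] at h2
  have e : (1 / ENNReal.toReal 1 - 1 / q) * q = q - 1 := by
    rw [ENNReal.toReal_one, sub_mul, one_div_mul_cancel hq0.ne']
    ring
  rwa [e] at h2

section
variable {X : Type*} [TopologicalSpace X] [CompactSpace X] [MeasurableSpace X]
  [OpensMeasurableSpace X] (μ : Measure X) [IsFiniteMeasure μ]

lemma lintegral_enorm_eq_ofReal_l1 {K : X → ℂ} (hK : Continuous K) :
    ∫⁻ w, ‖K w‖ₑ ∂μ = ENNReal.ofReal (l1 μ K) :=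
  (ofReal_integral_norm_eq_lintegral_enorm (integrable_of_continuous μ hK)).symm

lemma enorm_integral_mul_le {K : X → ℂ} (hK : Continuous K) {g : X → ℂ} {C : ℝ≥0∞}
    (hC : ∀ w, K w ≠ 0 → ‖g w‖ₑ ≤ C) :
    ‖∫ w, K w * g w ∂μ‖ₑ ≤ ENNReal.ofReal (l1 μ K) * C := by
  refine (enorm_integral_le_lintegral_enorm _).trans ?_
  rw [← lintegral_enorm_eq_ofReal_l1 μ hK,
    ← lintegral_mul_const _ (hK.enorm.measurable)]
  refine lintegral_mono fun w => ?_
  rw [enorm_mul]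
  by_cases h : K w = 0
  · simp [h]
  · exact mul_le_mul_right (hC w h) _

/-- Minkowski's integral inequality, from the weighted Jensen inequality and Tonelli. Control of g
is asked only where K does not vanish, so that for K = D_{M_n} ⊗ D_{M_n} only translations by I_n ×
I_n enter. -/
lemma eLpNorm_integral_mul_le {K : X → ℂ} (hK : Continuous K) {g : X → X → ℂ}
    (hg : AEStronglyMeasurable (Function.uncurry g) (μ.prod μ)) {p : ℝ≥0∞} (hp : 1 ≤ p)
    (hp' : p ≠ ∞) {C : ℝ≥0∞} (hC : ∀ w, K w ≠ 0 → eLpNorm (fun z => g z w) p μ ≤ C) :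
    eLpNorm (fun z => ∫ w, K w * g z w ∂μ) p μ ≤ ENNReal.ofReal (l1 μ K) * C := by
  have hp0 : p ≠ 0 := (one_pos.trans_le hp).ne'
  set q := p.toReal with hq
  have hq1 : 1 ≤ q := by
    rw [hq, ← ENNReal.toReal_one]; exact ENNReal.toReal_mono hp' hp
  have hq0 : 0 < q := one_pos.trans_le hq1
  set κ := ∫⁻ w, ‖K w‖ₑ ∂μ with hκ
  rw [← lintegral_enorm_eq_ofReal_l1 μ hK, ← hκ, eLpNorm_eq_lintegral_rpow_enorm_toReal hp0 hp',
    ← hq, one_div, ENNReal.rpow_inv_le_iff hq0]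
  have hC' : ∀ w, K w ≠ 0 → ∫⁻ z, ‖g z w‖ₑ ^ q ∂μ ≤ C ^ q := by
    intro w hw
    have := hC w hw
    rwa [eLpNorm_eq_lintegral_rpow_enorm_toReal hp0 hp', ← hq, one_div,
      ENNReal.rpow_inv_le_iff hq0] at this
  have hKm : Measurable fun w => ‖K w‖ₑ := hK.enorm.measurable
  calc ∫⁻ z, ‖∫ w, K w * g z w ∂μ‖ₑ ^ q ∂μ
      ≤ ∫⁻ z, (∫⁻ w, ‖K w‖ₑ * ‖g z w‖ₑ ^ q ∂μ) * κ ^ (q - 1) ∂μ := by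
        refine lintegral_mono_ae ?_
        filter_upwards [hg.prodMk_left] with z hz
        refine le_trans ?_ (lintegral_mul_enorm_rpow_le hKm (fun w => enorm_lt_top) hz hq1)
        refine ENNReal.rpow_le_rpow ?_ hq0.le
        refine (enorm_integral_le_lintegral_enorm _).trans (le_of_eq ?_)
        simp only [enorm_mul, Function.uncurry]
    _ = (∫⁻ z, ∫⁻ w, ‖K w‖ₑ * ‖g z w‖ₑ ^ q ∂μ ∂μ) * κ ^ (q - 1) := by
        rw [lintegral_mul_const']
        refine ENNReal.rpow_ne_top_of_nonneg (by linarith) ?_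
        rw [hκ, lintegral_enorm_eq_ofReal_l1 μ hK]
        exact ENNReal.ofReal_ne_top
    _ = (∫⁻ w, ∫⁻ z, ‖K w‖ₑ * ‖g z w‖ₑ ^ q ∂μ ∂μ) * κ ^ (q - 1) := by
        rw [lintegral_lintegral_swap]
        exact ((hKm.comp measurable_snd).aemeasurable).mul (hg.enorm.pow_const q)
    _ ≤ (∫⁻ w, ‖K w‖ₑ * C ^ q ∂μ) * κ ^ (q - 1) := by
        gcongr with w
        rw [lintegral_const_mul' _ _ enorm_ne_top]
        by_cases h : K w = 0
        · simp [h]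
        · exact mul_le_mul_right (hC' w h) _
    _ = (κ * C) ^ q := by
        rw [lintegral_mul_const _ hKm, ENNReal.mul_rpow_of_nonneg _ _ hq0.le, mul_right_comm]
        congr 1
        nth_rewrite 1 [← hκ, ← ENNReal.rpow_one κ]
        rw [← ENNReal.rpow_add_of_nonneg _ _ one_pos.le (by linarith)]
        congr 1
        ring

end

/-! ### The spaces `L^p(G_m × G_m)` -/

section
variable (m : ℕ → ℕ) [∀ k, NeZero (m k)] {p : ℝ≥0∞}
  {f g : Group m × Group m → ℂ}

lemma InLp.of_continuous (hf : Continuous f) : InLp m p f := by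
  unfold InLp
  split_ifs
  · exact hf
  · exact hf.memLp_of_hasCompactSupport (HasCompactSupport.of_compactSpace _)

variable {m}

lemma InLp.memLp (hf : InLp m p f) : MemLp f p (haar₂ m) := by
  unfold InLp at hf
  split_ifs at hf
  · exact hf.memLp_of_hasCompactSupport (HasCompactSupport.of_compactSpace _)
  · exact hf

lemma InLp.integrable (hp : 1 ≤ p) (hf : InLp m p f) : Integrable f (haar₂ m) :=
  hf.memLp.integrable hp

lemma InLp.add (hf : InLp m p f) (hg : InLp m p g) : InLp m p fun z => f z + g z := by
  unfold InLp at *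
  split_ifs at *
  · exact Continuous.add hf hg
  · exact MemLp.add hf hg

lemma InLp.sub (hf : InLp m p f) (hg : InLp m p g) : InLp m p fun z => f z - g z := by
  unfold InLp at *
  split_ifs at *
  · exact Continuous.sub hf hg
  · exact MemLp.sub hf hg

lemma InLp.const_mul (c : ℂ) (hf : InLp m p f) : InLp m p fun z => c * f z := by
  unfold InLp at *
  split_ifs at *
  · exact Continuous.mul continuous_const hf
  · exact MemLp.const_mul hf c

lemma InLp.comp_add_left (hf : InLp m p f) (a : Group m × Group m) :
    InLp m p fun z => f (a + z) := by
  unfold InLp at *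
  split_ifs at *
  · exact Continuous.comp hf (continuous_const.add continuous_id)
  · exact hf.comp_measurePreserving (measurePreserving_add_left _ a)

lemma normLp_congr_norm (h : ∀ z, ‖f z‖ = ‖g z‖) : normLp m p f = normLp m p g := by
  have h' : ∀ z, ‖f z‖ₑ = ‖g z‖ₑ := fun z => by simp only [← ofReal_norm, h]
  unfold normLp
  split_ifs
  · simp only [h']
  · exact eLpNorm_congr_norm_ae (Filter.Eventually.of_forall h)

lemma normLp_add_le (hp : 1 ≤ p) (hf : InLp m p f) (hg : InLp m p g) :
    normLp m p (fun z => f z + g z) ≤ normLp m p f + normLp m p g := by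
  unfold normLp
  split_ifs with h
  · refine iSup_le fun z => (enorm_add_le _ _).trans (add_le_add ?_ ?_)
    · exact le_iSup (fun z => ‖f z‖ₑ) z
    · exact le_iSup (fun z => ‖g z‖ₑ) z
  · exact eLpNorm_add_le hf.memLp.1 hg.memLp.1 hp

lemma normLp_sub_le (hp : 1 ≤ p) (hf : InLp m p f) (hg : InLp m p g) :
    normLp m p (fun z => f z - g z) ≤ normLp m p f + normLp m p g := by
  have h := normLp_add_le hp hf (hg.const_mul (-1))
  rw [normLp_congr_norm (f := fun z => -1 * g z) (g := g) fun z => by simp] at h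
  convert h using 3
  ring

lemma normLp_zero : normLp m p (fun _ => 0) = 0 := by
  unfold normLp
  split_ifs <;> simp

lemma normLp_const_mul_le (c : ℂ) : normLp m p (fun z => c * f z) ≤ ‖c‖ₑ * normLp m p f := by
  unfold normLp
  split_ifs with h
  · refine iSup_le fun z => ?_
    rw [enorm_mul]
    exact mul_le_mul_right (le_iSup (fun z => ‖f z‖ₑ) z) _
  · exact eLpNorm_const_smul_le (c := c) (f := f)

lemma InLp.sum {ι : Type*} (s : Finset ι) {F : ι → Group m × Group m → ℂ}
    (hF : ∀ i ∈ s, InLp m p (F i)) : InLp m p fun z => ∑ i ∈ s, F i z := by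
  classical
  induction s using Finset.induction_on with
  | empty => simpa using InLp.of_continuous m continuous_const
  | insert i s hi ih =>
    simp only [Finset.sum_insert hi]
    exact (hF i (by simp)).add (ih fun j hj => hF j (by simp [hj]))

lemma normLp_sum_le (hp : 1 ≤ p) {ι : Type*} (s : Finset ι) {F : ι → Group m × Group m → ℂ}
    (hF : ∀ i ∈ s, InLp m p (F i)) :
    normLp m p (fun z => ∑ i ∈ s, F i z) ≤ ∑ i ∈ s, normLp m p (F i) := by
  classical
  induction s using Finset.induction_on with
  | empty => simp [normLp_zero]
  | insert i s hi ih =>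
    simp only [Finset.sum_insert hi]
    have hs : ∀ j ∈ s, InLp m p (F j) := fun j hj => hF j (by simp [hj])
    exact (normLp_add_le hp (hF i (by simp)) (InLp.sum s hs)).trans
      (add_le_add_right (ih hs) _)

lemma normLp_comp_add_left (hf : InLp m p f) (a : Group m × Group m) :
    normLp m p (fun z => f (a + z)) = normLp m p f := by
  unfold normLp
  split_ifs with h
  · exact (Equiv.addLeft a).iSup_congr fun z => rfl
  · exact eLpNorm_comp_measurePreserving hf.memLp.1 (measurePreserving_add_left _ a)

lemma normLp_integral_mul_le (hp : 1 ≤ p) {K : Group m × Group m → ℂ} (hK : Continuous K)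
    {g : Group m × Group m → Group m × Group m → ℂ}
    (hg : AEStronglyMeasurable (Function.uncurry g) ((haar₂ m).prod (haar₂ m))) {C : ℝ≥0∞}
    (hC : ∀ w, K w ≠ 0 → normLp m p (fun z => g z w) ≤ C) :
    normLp m p (fun z => ∫ w, K w * g z w ∂(haar₂ m)) ≤ ENNReal.ofReal (l1 (haar₂ m) K) * C := by
  unfold normLp at *
  split_ifs at * with h
  · exact iSup_le fun z => enorm_integral_mul_le _ hK fun w hw =>
      (le_iSup (fun z => ‖g z w‖ₑ) z).trans (hC w hw)
  · exact eLpNorm_integral_mul_le _ hK hg hp h hC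

lemma aestronglyMeasurable_comp_sub (hf : AEStronglyMeasurable f (haar₂ m)) :
    AEStronglyMeasurable (Function.uncurry fun z w => f (z - w))
      ((haar₂ m).prod (haar₂ m)) :=
  hf.comp_quasiMeasurePreserving (quasiMeasurePreserving_sub (haar₂ m) (haar₂ m))

/-- Convolution on `G_m × G_m`. -/
def conv (K f : Group m × Group m → ℂ) (z : Group m × Group m) : ℂ :=
  ∫ w, K w * f (z - w) ∂(haar₂ m)

lemma integrable_continuous_mul {K f : Group m × Group m → ℂ} (hK : Continuous K)
    (hf : Integrable f (haar₂ m)) : Integrable (fun w => K w * f w) (haar₂ m) := by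
  obtain ⟨C, hC⟩ := isCompact_univ.exists_bound_of_continuousOn hK.continuousOn
  exact hf.bdd_mul hK.aestronglyMeasurable (c := C)
    (Filter.Eventually.of_forall fun x => hC x (Set.mem_univ x))

lemma integrable_conv {K f : Group m × Group m → ℂ} (hK : Continuous K)
    (hf : Integrable f (haar₂ m)) (z : Group m × Group m) :
    Integrable (fun w => K w * f (z - w)) (haar₂ m) :=
  integrable_continuous_mul hK (hf.comp_sub_left z)

lemma normLp_conv_le (hp : 1 ≤ p) {K : Group m × Group m → ℂ} (hK : Continuous K)
    (hf : InLp m p f) :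
    normLp m p (conv K f) ≤ ENNReal.ofReal (l1 (haar₂ m) K) * normLp m p f := by
  refine normLp_integral_mul_le hp hK (aestronglyMeasurable_comp_sub hf.memLp.1) fun w _ => ?_
  rw [← normLp_comp_add_left hf (-w)]
  simp only [sub_eq_neg_add, le_refl]

lemma conv_sub {K f g : Group m × Group m → ℂ} (hK : Continuous K)
    (hf : Integrable f (haar₂ m)) (hg : Integrable g (haar₂ m)) (z : Group m × Group m) :
    conv K (fun z => f z - g z) z = conv K f z - conv K g z := by
  simp only [conv, mul_sub]
  exact integral_sub (integrable_conv hK hf z) (integrable_conv hK hg z)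

lemma conv_sum {ι : Type*} (s : Finset ι) (c : ι → ℂ) {K : ι → Group m × Group m → ℂ}
    (hK : ∀ i ∈ s, Continuous (K i)) (hf : Integrable f (haar₂ m)) (z : Group m × Group m) :
    conv (fun w => ∑ i ∈ s, c i * K i w) f z = ∑ i ∈ s, c i * conv (K i) f z := by
  simp only [conv, Finset.sum_mul, mul_assoc]
  rw [integral_finsetSum]
  · simp only [integral_const_mul]
  · exact fun i hi => (integrable_conv (hK i hi) hf z).const_mul _

/-! ### Partial sums -/

lemma partialSum_eq_conv (hf : Integrable f (haar₂ m)) (j : ℕ) (z : Group m × Group m) :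
    partialSum m j j f z = conv (fun w => dirichlet m j w.1 * dirichlet m j w.2) f z := by
  rw [conv, ← integral_sub_left_eq_self _ _ z]
  simp only [sub_sub_cancel, Prod.fst_sub, Prod.snd_sub, dirichlet, psi_sub, Finset.sum_mul_sum]
  simp only [Finset.sum_mul]
  have hint : ∀ a b : ℕ, Integrable (fun w => psi m a z.1 * starRingEnd ℂ (psi m a w.1) *
      (psi m b z.2 * starRingEnd ℂ (psi m b w.2)) * f w) (haar₂ m) := fun a b =>
    integrable_continuous_mul (by
      have := Complex.continuous_conj
      fun_prop) hf
  rw [integral_finsetSum _ fun a _ => integrable_finsetSum _ fun b _ => hint a b]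
  refine Finset.sum_congr rfl fun a _ => ?_
  rw [integral_finsetSum _ fun b _ => hint a b]
  refine Finset.sum_congr rfl fun b _ => ?_
  rw [fourierCoeff, ← integral_mul_const, ← integral_mul_const]
  refine integral_congr_ae (Filter.Eventually.of_forall fun w => ?_)
  simp only
  ring

@[fun_prop]
lemma continuous_partialSum (j n : ℕ) (f : Group m × Group m → ℂ) :
    Continuous (partialSum m j n f) := by
  unfold partialSum; fun_prop

lemma fourierCoeff_partialSum (hm : ∀ k, 2 ≤ m k) (n a b : ℕ) (f : Group m × Group m → ℂ) :
    fourierCoeff m (partialSum m n n f) a b =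
      if a < n ∧ b < n then fourierCoeff m f a b else 0 := by
  have hconj := Complex.continuous_conj
  have h : ∀ z : Group m × Group m, partialSum m n n f z * starRingEnd ℂ (psi m a z.1) *
      starRingEnd ℂ (psi m b z.2) = ∑ k₁ ∈ Finset.range n, ∑ k₂ ∈ Finset.range n,
      fourierCoeff m f k₁ k₂ * ((psi m k₁ z.1 * starRingEnd ℂ (psi m a z.1)) *
        (psi m k₂ z.2 * starRingEnd ℂ (psi m b z.2))) := fun z => by
    simp only [partialSum, Finset.sum_mul]
    exact Finset.sum_congr rfl fun _ _ => Finset.sum_congr rfl fun _ _ => by ring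
  have hint : ∀ k₁ k₂ : ℕ, Integrable (fun z : Group m × Group m => fourierCoeff m f k₁ k₂ *
      ((psi m k₁ z.1 * starRingEnd ℂ (psi m a z.1)) *
        (psi m k₂ z.2 * starRingEnd ℂ (psi m b z.2)))) (haar₂ m) := fun k₁ k₂ =>
    integrable_of_continuous _ (by fun_prop)
  have hprod : ∀ k₁ k₂ : ℕ, ∫ z, (psi m k₁ z.1 * starRingEnd ℂ (psi m a z.1)) *
        (psi m k₂ z.2 * starRingEnd ℂ (psi m b z.2)) ∂(haar₂ m) =
        (if k₁ = a then 1 else 0) * (if k₂ = b then 1 else 0) := fun k₁ k₂ => by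
    rw [← integral_psi_mul_conj m hm, ← integral_psi_mul_conj m hm]
    exact integral_prod_mul (μ := haar m) (ν := haar m)
      (fun x => psi m k₁ x * starRingEnd ℂ (psi m a x))
      (fun x => psi m k₂ x * starRingEnd ℂ (psi m b x))
  rw [fourierCoeff]
  simp only [h]
  rw [integral_finsetSum _ fun k₁ _ => integrable_finsetSum _ fun k₂ _ => hint k₁ k₂]
  simp only [integral_finsetSum _ fun k₂ _ => hint _ k₂, integral_const_mul, hprod]
  by_cases ha : a < n <;> by_cases hb : b < n <;> simp [ha, hb]

lemma partialSum_partialSum (hm : ∀ k, 2 ≤ m k) {n j : ℕ} (hj : n ≤ j)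
    (f : Group m × Group m → ℂ) (z : Group m × Group m) :
    partialSum m j j (partialSum m n n f) z = partialSum m n n f z := by
  rw [partialSum, partialSum]
  simp only [fourierCoeff_partialSum hm]
  refine (Finset.sum_subset (Finset.range_mono hj) fun a _ ha => ?_).symm.trans
    (Finset.sum_congr rfl fun a ha =>
      (Finset.sum_subset (Finset.range_mono hj) fun b _ hb => ?_).symm.trans
      (Finset.sum_congr rfl fun b hb => ?_))
  · refine Finset.sum_eq_zero fun b _ => ?_
    rw [if_neg (by simp at ha; omega)]
    ring
  · rw [if_neg (by simp at hb; omega)]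
    ring
  · rw [if_pos (by simp at ha hb; omega)]

/-- Both S_{j,j} and the identity fix S_{n,n} f, so it can be subtracted from f. -/
lemma partialSum_sub_self (hm : ∀ k, 2 ≤ m k) {n j : ℕ} (hj : n ≤ j)
    (hf : Integrable f (haar₂ m)) (z : Group m × Group m) :
    partialSum m j j f z - f z =
      conv (fun w => dirichlet m j w.1 * dirichlet m j w.2) (fun w => f w - partialSum m n n f w) z
        - (f z - partialSum m n n f z) := by
  have hc : Integrable (partialSum m n n f) (haar₂ m) :=
    integrable_of_continuous _ (by fun_prop)
  rw [conv_sub (by fun_prop) hf hc, ← partialSum_eq_conv hf, ← partialSum_eq_conv hc,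
    partialSum_partialSum hm hj]
  ring

omit [∀ k, NeZero (m k)] in
lemma neg_mem_cyl {n : ℕ} {u : Group m} (hu : u ∈ cyl m n) : -u ∈ cyl m n := fun i hi => by
  rw [Pi.neg_apply, hu i hi, neg_zero]

/-- The two coordinates are translated one after the other; translation invariance of the norm
removes the intermediate shift. -/
lemma normLp_sub_translate_le (hp : 1 ≤ p) (hf : InLp m p f) {n : ℕ} {w : Group m × Group m}
    (h1 : w.1 ∈ cyl m n) (h2 : w.2 ∈ cyl m n) :
    normLp m p (fun z => f z - f (z - w)) ≤ modulus₁ m p f n + modulus₂ m p f n := by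
  set a : Group m × Group m := (-w.1, 0) with ha
  set b : Group m × Group m := (0, -w.2) with hb
  have hF : InLp m p fun z => f (a + z) - f z := (hf.comp_add_left a).sub hf
  have hH : InLp m p fun z => f (b + z) - f z := (hf.comp_add_left b).sub hf
  have e : ∀ z, ‖f z - f (z - w)‖ =
      ‖(f (a + z) - f z) + (fun z => f (b + z) - f z) (a + z)‖ := fun z => by
    have : b + (a + z) = z - w := by
      rw [ha, hb]; ext <;> simp [sub_eq_neg_add]
    simp only [this]
    rw [← norm_neg]
    congr 1
    ring
  rw [normLp_congr_norm e]
  refine (normLp_add_le hp hF (hH.comp_add_left a)).trans (add_le_add ?_ ?_)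
  · refine le_trans (le_of_eq ?_) (le_iSup₂ (f := fun u (_ : u ∈ cyl m n) =>
      normLp m p fun z => f (z.1 + u, z.2) - f z) (-w.1) (neg_mem_cyl h1))
    congr 1
    ext z
    rw [ha, add_comm _ z, Prod.add_def]
    simp
  · rw [normLp_comp_add_left hH a]
    refine le_trans (le_of_eq ?_) (le_iSup₂ (f := fun u (_ : u ∈ cyl m n) =>
      normLp m p fun z => f (z.1, z.2 + u) - f z) (-w.2) (neg_mem_cyl h2))
    congr 1
    ext z
    rw [hb, add_comm _ z, Prod.add_def]
    simp

/-- The kernel D_{M_n} ⊗ D_{M_n} has integral and L¹ norm 1 and is supported in I_n × I_n, so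
S_{M_n,M_n} f averages translates of f over that subgroup. -/
lemma normLp_sub_partialSum_le (hm : ∀ k, 2 ≤ m k) (hp : 1 ≤ p) (hf : InLp m p f) (n : ℕ) :
    normLp m p (fun z => f z - partialSum m (M m n) (M m n) f z) ≤
      modulus₁ m p f n + modulus₂ m p f n := by
  set K : Group m × Group m → ℂ := fun w => dirichlet m (M m n) w.1 * dirichlet m (M m n) w.2
  have hK : Continuous K := by fun_prop
  have hint := hf.integrable hp
  have hK1 : ∫ w, K w ∂(haar₂ m) = 1 := by
    have := integral_prod_mul (μ := haar m) (ν := haar m) (dirichlet m (M m n))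
      (dirichlet m (M m n))
    rwa [integral_dirichlet m hm (M_pos m hm n), mul_one] at this
  have e : (fun z => f z - partialSum m (M m n) (M m n) f z) =
      fun z => ∫ w, K w * (f z - f (z - w)) ∂(haar₂ m) := by
    ext z
    simp only [mul_sub]
    rw [integral_sub ((integrable_of_continuous _ hK).mul_const _) (integrable_conv hK hint z),
      integral_mul_const, hK1, one_mul, partialSum_eq_conv hint, conv]
  have hl1 : l1 (haar₂ m) K = 1 := by
    rw [l1_tensor, l1_dirichlet_M m hm, one_mul]
  rw [e]
  refine (normLp_integral_mul_le hp hK (C := modulus₁ m p f n + modulus₂ m p f n) ?_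
    fun w hw => ?_).trans (by rw [hl1]; simp)
  · exact hf.memLp.1.comp_fst.sub (aestronglyMeasurable_comp_sub hf.memLp.1)
  · have h1 : w.1 ∈ cyl m n := by
      by_contra h
      exact hw (by simp [K, dirichlet_M m hm, h])
    have h2 : w.2 ∈ cyl m n := by
      by_contra h
      exact hw (by simp [K, dirichlet_M m hm, h])
    exact normLp_sub_translate_le hp hf h1 h2

end

/-! ### Approximation by Cesàro means -/

section
variable {m : ℕ → ℕ} [∀ k, NeZero (m k)] {p : ℝ≥0∞} {f : Group m × Group m → ℂ}

/-- Each D_j ⊗ D_j with j > 0 has integral 1, so the sum of the coefficients is the integral of the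
kernel. -/
lemma abs_sum_le_l1 (hm : ∀ k, 2 ≤ m k) (s : Finset ℕ) (hs : ∀ j ∈ s, 0 < j) (c : ℕ → ℂ) :
    ‖∑ j ∈ s, c j‖ ≤
      l1 (haar₂ m) (fun w => ∑ j ∈ s, c j * (dirichlet m j w.1 * dirichlet m j w.2)) := by
  refine le_trans (le_of_eq ?_) (norm_integral_le_integral_norm _)
  rw [integral_finsetSum _ fun j _ => integrable_of_continuous _ (by fun_prop)]
  congr 1
  refine Finset.sum_congr rfl fun j hj => ?_
  have := integral_prod_mul (μ := haar m) (ν := haar m) (dirichlet m j) (dirichlet m j)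
  rw [integral_dirichlet m hm (hs j hj), mul_one] at this
  rw [integral_const_mul, haar₂, this, mul_one]

/-- With h = f - S_{M_r,M_r} f the sum becomes K * h - (∑ c_j) h. Both terms are controlled by the
L¹ norm of K, whence the factor 2. -/
lemma normLp_block_le (hm : ∀ k, 2 ≤ m k) (hp : 1 ≤ p) (hf : InLp m p f) {r : ℕ} {s : Finset ℕ}
    (hs : ∀ j ∈ s, M m r ≤ j) (c : ℕ → ℂ) :
    normLp m p (fun z => ∑ j ∈ s, c j * (partialSum m j j f z - f z)) ≤
      ENNReal.ofReal (2 * l1 (haar₂ m) (fun w => ∑ j ∈ s, c j *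
        (dirichlet m j w.1 * dirichlet m j w.2))) * (modulus₁ m p f r + modulus₂ m p f r) := by
  set K : Group m × Group m → ℂ := fun w => ∑ j ∈ s, c j *
    (dirichlet m j w.1 * dirichlet m j w.2) with hKdef
  set h : Group m × Group m → ℂ := fun z => f z - partialSum m (M m r) (M m r) f z with hh
  have hK : Continuous K := by fun_prop
  have hint := hf.integrable hp
  have hhp : InLp m p h := hf.sub (InLp.of_continuous m (by fun_prop))
  have e : (fun z => ∑ j ∈ s, c j * (partialSum m j j f z - f z)) =
      fun z => (∑ j ∈ s, c j * partialSum m j j h z) - (∑ j ∈ s, c j) * h z := by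
    ext z
    rw [Finset.sum_mul, ← Finset.sum_sub_distrib]
    refine Finset.sum_congr rfl fun j hj => ?_
    rw [partialSum_sub_self hm (hs j hj) hint, ← partialSum_eq_conv (hhp.integrable hp)]
    ring
  have e2 : (fun z => ∑ j ∈ s, c j * partialSum m j j h z) = conv K h := by
    ext z
    rw [hKdef, conv_sum _ _ (fun i _ => by fun_prop) (hhp.integrable hp)]
    simp only [partialSum_eq_conv (hhp.integrable hp)]
  have hc : ‖∑ j ∈ s, c j‖ₑ ≤ ENNReal.ofReal (l1 (haar₂ m) K) := by
    rw [← ofReal_norm]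
    exact ENNReal.ofReal_le_ofReal
      (abs_sum_le_l1 hm s (fun j hj => (M_pos m hm r).trans_le (hs j hj)) c)
  have h2 : ENNReal.ofReal (2 * l1 (haar₂ m) K) =
      ENNReal.ofReal (l1 (haar₂ m) K) + ENNReal.ofReal (l1 (haar₂ m) K) := by
    rw [← ENNReal.ofReal_add (l1_nonneg _ _) (l1_nonneg _ _), two_mul]
  have hω := normLp_sub_partialSum_le hm hp hf r
  rw [e, h2, add_mul]
  refine (normLp_sub_le hp (InLp.of_continuous m (by fun_prop)) (hhp.const_mul _)).trans
    (add_le_add ?_ ?_)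
  · rw [e2]
    exact (normLp_conv_le hp hK hhp).trans (mul_le_mul_right hω _)
  · exact (normLp_const_mul_le _).trans (mul_le_mul' hc hω)

lemma sum_Ico_one_M {E : Type*} [AddCommMonoid E] (m : ℕ → ℕ) (hm : ∀ k, 2 ≤ m k) (n : ℕ)
    (F : ℕ → E) : ∑ j ∈ Finset.Ico 1 (M m n), F j =
      ∑ r ∈ Finset.range n, ∑ j ∈ Finset.Ico (M m r) (M m (r + 1)), F j := by
  induction n with
  | zero => simp [M]
  | succ n ih =>
    rw [Finset.sum_range_succ, ← ih, Finset.sum_Ico_consecutive _ (M_pos m hm n)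
      (M_mono m hm (Nat.le_add_right n 1))]

lemma cesaroMean_sub_self (hm : ∀ k, 2 ≤ m k) {α : ℝ} (hα₀ : 0 < α) (hα₁ : α < 1) (n : ℕ)
    (f : Group m × Group m → ℂ) (z : Group m × Group m) :
    cesaroMean m (-α) (M m (n + 1)) f z - f z =
      ((1 / cesaroNumber (-α) (M m (n + 1) - 1) : ℝ) : ℂ) *
      (∑ r ∈ Finset.range n, ∑ j ∈ Finset.Ico (M m r) (M m (r + 1)),
        (cesaroNumber (-α - 1) (M m (n + 1) - j) : ℂ) * (partialSum m j j f z - f z) +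
      ∑ j ∈ Finset.Ico (M m n) (M m (n + 1) + 1),
        (cesaroNumber (-α - 1) (M m (n + 1) - j) : ℂ) * (partialSum m j j f z - f z)) := by
  set N := M m (n + 1) with hN
  have hN0 : 0 < N := M_pos m hm _
  have hA := (cesaroNumber_neg_pos hα₀ hα₁ (N - 1)).ne'
  -- The normalization of the means: subtracting f inside the sum removes exactly one copy of f.
  have hsum : ∑ j ∈ Finset.Ico 1 (N + 1), cesaroNumber (-α - 1) (N - j) =
      cesaroNumber (-α) (N - 1) := by
    rw [← sum_cesaroNumber, Nat.sub_add_cancel hN0, ← Finset.sum_range_reflect,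
      Finset.sum_Ico_eq_sum_range, Nat.add_sub_cancel]
    exact Finset.sum_congr rfl fun j _ => by rw [Nat.sub_sub]
  rw [← sum_Ico_one_M m hm, Finset.sum_Ico_consecutive _ (M_pos m hm n)
    ((M_mono m hm (Nat.le_add_right n 1)).trans (Nat.le_add_right _ 1))]
  simp only [mul_sub, Finset.sum_sub_distrib]
  rw [← Finset.sum_mul, ← Complex.ofReal_sum, hsum, ← mul_assoc, ← Complex.ofReal_mul,
    one_div_mul_cancel hA, cesaroMean, Complex.ofReal_one, one_mul]
  rfl

lemma l1_upper_block_le (hm : ∀ k, 2 ≤ m k) {B : ℕ} (hB : ∀ k, m k ≤ B) {α : ℝ} (hα₀ : 0 < α)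
    (hα₁ : α < 1) (n : ℕ) :
    l1 (haar₂ m) (fun w => ∑ j ∈ Finset.Ico (M m n) (M m (n + 1) + 1),
      (cesaroNumber (-α - 1) (M m (n + 1) - j) : ℂ) *
        (dirichlet m j w.1 * dirichlet m j w.2)) ≤ upperKernelConst B := by
  refine le_trans (le_of_eq ?_) (l1_upper_kernel_le m hm hB hα₀ hα₁ (k := n + 1)
    (L := M m (n + 1) + 1 - M m n) (Nat.sub_le _ _))
  refine l1_congr_norm _ fun z => congrArg _ ?_
  have hle := M_mono m hm (Nat.le_add_right n 1)
  refine Finset.sum_nbij' (fun j => M m (n + 1) - j) (fun j => M m (n + 1) - j) ?_ ?_ ?_ ?_ ?_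
  · intro j hj; simp only [Finset.mem_Ico, Finset.mem_range] at *; omega
  · intro j hj; simp only [Finset.mem_Ico, Finset.mem_range] at *; omega
  · intro j hj; simp only [Finset.mem_Ico] at *; omega
  · intro j hj; simp only [Finset.mem_range] at *; omega
  · intro j hj
    simp only [Finset.mem_Ico] at hj
    rw [Nat.sub_sub_self (by omega)]

lemma normLp_cesaroMean_sub_le (hm : ∀ k, 2 ≤ m k) {B : ℕ} (hB : ∀ k, m k ≤ B) {α : ℝ}
    (hα₀ : 0 < α) (hα₁ : α < 1) (hp : 1 ≤ p) (hf : InLp m p f) (n : ℕ) :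
    normLp m p (fun z => cesaroMean m (-α) (M m (n + 1)) f z - f z) ≤
      ENNReal.ofReal ((1 - α)⁻¹ * (M m (n + 1) : ℝ) ^ α) *
      (∑ r ∈ Finset.range n, ENNReal.ofReal (2 * (16 * marcinkiewiczConst B * B * M m r *
          (M m (n + 1) : ℝ) ^ (-1 - α))) * (modulus₁ m p f r + modulus₂ m p f r) +
        ENNReal.ofReal (2 * upperKernelConst B) * (modulus₁ m p f n + modulus₂ m p f n)) := by
  have hInLp : ∀ s : Finset ℕ, InLp m p fun z => ∑ j ∈ s,
      (cesaroNumber (-α - 1) (M m (n + 1) - j) : ℂ) * (partialSum m j j f z - f z) := fun s =>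
    InLp.sum s fun j _ => ((InLp.of_continuous m (by fun_prop)).sub hf).const_mul _
  simp only [cesaroMean_sub_self hm hα₀ hα₁ n f]
  refine (normLp_const_mul_le _).trans (mul_le_mul' ?_ ?_)
  · rw [← ofReal_norm, Complex.norm_real, Real.norm_of_nonneg
      (one_div_nonneg.2 (cesaroNumber_neg_pos hα₀ hα₁ _).le)]
    exact ENNReal.ofReal_le_ofReal (inv_cesaroNumber_neg_le hα₀ hα₁ (M_pos m hm _))
  · refine (normLp_add_le hp (InLp.sum _ fun r _ => hInLp _) (hInLp _)).trans (add_le_add ?_ ?_)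
    · refine (normLp_sum_le hp _ fun r _ => hInLp _).trans (Finset.sum_le_sum fun r hr => ?_)
      refine (normLp_block_le hm hp hf (r := r)
        (fun j hj => (Finset.mem_Ico.1 hj).1) _).trans (mul_le_mul_left ?_ _)
      exact ENNReal.ofReal_le_ofReal (mul_le_mul_of_nonneg_left
        (l1_lower_kernel_le m hm hB hα₀ hα₁ (Finset.mem_range.1 hr)) two_pos.le)
    · refine (normLp_block_le hm hp hf (r := n)
        (fun j hj => (Finset.mem_Ico.1 hj).1) _).trans (mul_le_mul_left ?_ _)
      exact ENNReal.ofReal_le_ofReal (mul_le_mul_of_nonneg_left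
        (l1_upper_block_le hm hB hα₀ hα₁ n) two_pos.le)

end

end Vilenkin

end

theorem theorem1 (α : ℝ) (hα₀ : 0 < α) (hα₁ : α < 1) (B : ℕ) :
    ∃ c : ℝ≥0, ∀ (m : ℕ → ℕ) [∀ k, NeZero (m k)], (∀ k, 2 ≤ m k) → (∀ k, m k ≤ B) →
      ∀ p : ℝ≥0∞, 1 ≤ p →
      ∀ f : Vilenkin.Group m × Vilenkin.Group m → ℂ, Vilenkin.InLp m p f →
      ∀ k : ℕ, 1 ≤ k →
        Vilenkin.normLp m p
            (fun z => Vilenkin.cesaroMean m (-α) (Vilenkin.M m k) f z - f z) ≤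
          (c : ℝ≥0∞) *
            ((Vilenkin.M m k : ℝ≥0∞) ^ α * Vilenkin.modulus₁ m p f (k - 1) +
              (Vilenkin.M m k : ℝ≥0∞) ^ α * Vilenkin.modulus₂ m p f (k - 1) +
              ∑ r ∈ Finset.range (k - 1),
                (Vilenkin.M m r : ℝ≥0∞) / (Vilenkin.M m k : ℝ≥0∞) *
                  (Vilenkin.modulus₁ m p f r + Vilenkin.modulus₂ m p f r)) := by
  have h1α : 0 < (1 - α)⁻¹ := inv_pos.2 (by linarith)
  have hm0 := Vilenkin.marcinkiewiczConst_nonneg B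
  have hu0 : 0 ≤ Vilenkin.upperKernelConst B := by
    unfold Vilenkin.upperKernelConst; positivity
  -- The constant c₁ collects the lower blocks and c₂ the last one; their sum serves for both.
  set c₁ : ℝ := (1 - α)⁻¹ * (2 * (16 * Vilenkin.marcinkiewiczConst B * B)) with hc₁
  set c₂ : ℝ := (1 - α)⁻¹ * (2 * Vilenkin.upperKernelConst B) with hc₂
  have hc₁0 : 0 ≤ c₁ := by positivity
  have hc₂0 : 0 ≤ c₂ := by positivity
  refine ⟨(c₁ + c₂).toNNReal, fun m _ hm hB p hp f hf k hk => ?_⟩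
  obtain ⟨n, rfl⟩ := Nat.exists_eq_add_of_le' hk
  rw [Nat.add_sub_cancel]
  refine (Vilenkin.normLp_cesaroMean_sub_le hm hB hα₀ hα₁ hp hf n).trans ?_
  have hN0 : (0 : ℝ) < Vilenkin.M m (n + 1) := by exact_mod_cast Vilenkin.M_pos m hm _
  have hcoe : (((c₁ + c₂).toNNReal : ℝ≥0) : ℝ≥0∞) = ENNReal.ofReal (c₁ + c₂) := rfl
  rw [hcoe, ← mul_add ((Vilenkin.M m (n + 1) : ℝ≥0∞) ^ α), mul_add (ENNReal.ofReal (c₁ + c₂)),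
    mul_add]
  refine (add_comm _ _).trans_le (add_le_add ?_ ?_)
  · refine (mul_assoc _ _ _).symm.trans_le (le_trans (mul_le_mul_left ?_ _) (mul_assoc _ _ _).le)
    rw [← ENNReal.ofReal_mul (by positivity), ← ENNReal.ofReal_natCast,
      ENNReal.ofReal_rpow_of_pos hN0, ← ENNReal.ofReal_mul (by positivity)]
    refine ENNReal.ofReal_le_ofReal ?_
    calc _ = c₂ * (Vilenkin.M m (n + 1) : ℝ) ^ α := by rw [hc₂]; ring
      _ ≤ _ := by gcongr; linarith
  · rw [Finset.mul_sum, Finset.mul_sum]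
    refine Finset.sum_le_sum fun r _ => ?_
    refine (mul_assoc _ _ _).symm.trans_le (le_trans (mul_le_mul_left ?_ _) (mul_assoc _ _ _).le)
    rw [← ENNReal.ofReal_mul (by positivity), ← ENNReal.ofReal_natCast (Vilenkin.M m r),
      ← ENNReal.ofReal_natCast (Vilenkin.M m (n + 1)), ← ENNReal.ofReal_div_of_pos hN0,
      ← ENNReal.ofReal_mul (by positivity)]
    refine ENNReal.ofReal_le_ofReal ?_
    -- The normalization N^α cancels against the weights of size N^{-1-α}, leaving the factor M_r/N.
    have hpow : (Vilenkin.M m (n + 1) : ℝ) ^ α * (Vilenkin.M m (n + 1) : ℝ) ^ (-1 - α) =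
        (Vilenkin.M m (n + 1) : ℝ)⁻¹ := by
      rw [← Real.rpow_add hN0, ← Real.rpow_neg_one]
      congr 1
      ring
    calc _ = c₁ * Vilenkin.M m r * ((Vilenkin.M m (n + 1) : ℝ) ^ α *
          (Vilenkin.M m (n + 1) : ℝ) ^ (-1 - α)) := by rw [hc₁]; ring
      _ = c₁ * (Vilenkin.M m r / Vilenkin.M m (n + 1)) := by rw [hpow]; ring
      _ ≤ _ := by gcongr; linarith
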